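/- **Definitions.** Let $\Sigma$ be a finite alphabet with $|\Sigma|\ge 2$ and $h\ge 1$. An *$h$-head finite-state gambler* $G$ consists of nonempty finite sets $T,Q$; maps $\delta_T:T\to T$ and $\delta_Q:Q\times\Sigma^h\to Q$; a movement function $\mu:T\to\{0,1\}^{h-1}$; a betting function $\beta$ from $Q$ to the rational-valued probability distributions on $\Sigma$; an initial state $(t_0,q_0)\in T\times Q$; and an initial capital $c_0\ge 0$. The $h-1$ trailing heads have positions $\pi(0)=(0,\dots,0)$, $\pi(n+1)=\pi(n)+\mu(\delta_T^{n}(t_0))$. On input $S\in\Sigma^\omega$ the states evolve by $q_{n+1}=\delta_Q\big(q_n,(S[\pi_1(n)],\dots,S[\pi_{h-1}(n)],S[n])\big)$. The martingale of $G$ is given by $d_G(\lambda)=c_0$ and $d_G(wb)=|\Sigma|\,d_G(w)\,\beta(q_{|w|})(b)$, where $q_{|w|}$ is the state after reading $w$, and for $s\ge 0$ its $s$-gale is $d_G^{(s)}(w)=|\Sigma|^{(s-1)|w|}d_G(w)$. The *$h$-head finite-state predimension* $\dim^{(h)}_{\mathrm{FS}}(S)$ (respectively *strong predimension* $\mathrm{Dim}^{(h)}_{\mathrm{FS}}(S)$)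 is the infimum of all $s\in[0,\infty)$ for which some $h$-head finite-state gambler $G$ satisfies $\limsup_{n\to\infty} d_G^{(s)}(S[0..n-1])=\infty$ (respectively $\liminf_{n\to\infty} d_G^{(s)}(S[0..n-1])=\infty$). Let $p_i$ be the $i$-th prime ($p_1=2$). For $h\ge 1$ and $S\in\{0,1\}^\omega$ define $F_{h+1}(S)\in\{0,1\}^\omega$ by $F_{h+1}(S)[0]=S[0]$ and, for $q\in\mathbb N$, $0\le r<p_{h+1}$ with $qp_{h+1}+r>0$, $$F_{h+1}(S)[qp_{h+1}+r]=\begin{cases}S[q(p_{h+1}-1)+r]&\text{if } r>0,\\ \bigoplus_{k=1}^{h}F_{h+1}(S)[qp_k]&\text{if } r=0.\end{cases}$$ A sequence $R\in\{0,1\}^\omega$ is *Martin-Löf random* if there is a constant $c$ with $K(R[0..n-1])\ge n-c$ for all $n$, where $K$ is prefix Kolmogorov complexity with respect to a universal prefix machine. **Theorem.** For each integer $h\ge 1$ there is a sequence $Y\in\{0,1\}^\omega$ such that $$\dim^{(h+1)}_{\mathrm{FS}}(Y)<\dim^{(h)}_{\mathrm{FS}}(Y)\quad\text{and}\quad \mathrm{Dim}^{(h+1)}_{\mathrm{FS}}(Y)<\mathrm{Dim}^{(h)}_{\mathrm{FS}}(Y),$$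 and $Y$ can be taken of the form $F_{h+1}(R)$ with $R$ Martin-Löf random. Moreover, for every Martin-Löf random $R\in\{0,1\}^\omega$, the sequence $Y=F_{h+1}(R)$ satisfies $$\dim^{(h)}_{\mathrm{FS}}(Y)=\mathrm{Dim}^{(h)}_{\mathrm{FS}}(Y)=1\quad\text{and}\quad \dim^{(h+1)}_{\mathrm{FS}}(Y)\le\mathrm{Dim}^{(h+1)}_{\mathrm{FS}}(Y)\le 1-\frac1{p_{h+1}}.$$ -/

import Mathlib

open Filter
open scoped NNReal ENNReal

/-- An `h`-head finite-state gambler (`1 ≤ h`) over the finite alphabet `α`.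
There are `h - 1` trailing heads and one leading head. The state set is `T × Q`; the transition
function `T × Q × α ^ h → T × Q` is the product of `stepT` and `stepQ`, where a vector of
`α ^ h` is given as the symbols under the trailing heads followed by the one under the leading
head. `move t i` says whether trailing head `i` advances in positional state `t`. -/
structure HeadGambler (h : ℕ) (α : Type) [Fintype α] [Nontrivial α] where
  T : Type
  Q : Type
  [finiteT : Finite T]
  [finiteQ : Finite Q]
  stepT : T → T
  stepQ : Q → (Fin (h - 1) → α) → α → Q
  move : T → Fin (h - 1) → Bool
  /-- The betting function, with values in the rational probability distributions on `α`. -/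
  bet : Q → α → ℚ≥0
  bet_sum : ∀ q, ∑ a, bet q a = 1
  t₀ : T
  q₀ : Q
  /-- The initial capital. -/
  c₀ : ℝ≥0

namespace HeadGambler

variable {h : ℕ} {α : Type} [Fintype α] [Nontrivial α]

/-- The positions of the trailing heads after `n` steps (the leading head is at `n`). -/
def position (G : HeadGambler h α) : ℕ → Fin (h - 1) → ℕ
  | 0 => fun _ => 0
  | n + 1 => fun i => G.position n i + (G.move (G.stepT^[n] G.t₀) i).toNat

theorem position_le (G : HeadGambler h α) (n : ℕ) (i : Fin (h - 1)) : G.position n i ≤ n := by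
  induction n with
  | zero => exact Nat.le_refl 0
  | succ n ih =>
    have := Bool.toNat_le (G.move (G.stepT^[n] G.t₀) i)
    simp only [position]
    omega

/-- The `Q`-component of the state after the leading head has read a string of length `n`. -/
def stateQ (G : HeadGambler h α) : (n : ℕ) → (Fin n → α) → G.Q
  | 0, _ => G.q₀
  | n + 1, w =>
    G.stepQ (G.stateQ n (Fin.init w))
      (fun i => w ⟨G.position n i, Nat.lt_succ_of_le (G.position_le n i)⟩) (w (Fin.last n))

/-- The martingale of a gambler, on strings of length `n`. -/
noncomputable def martingale (G : HeadGambler h α) : (n : ℕ) → (Fin n → α) → ℝ≥0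
  | 0, _ => G.c₀
  | n + 1, w =>
    Fintype.card α * G.martingale n (Fin.init w)
      * (G.bet (G.stateQ n (Fin.init w)) (w (Fin.last n)) : ℝ≥0)

/-- The `s`-gale of a gambler, on strings of length `n`. -/
noncomputable def gale (G : HeadGambler h α) (s : ℝ) (n : ℕ) (w : Fin n → α) : ℝ≥0 :=
  (Fintype.card α : ℝ≥0) ^ ((s - 1) * (n : ℝ)) * G.martingale n w

end HeadGambler

/-- The prefix of length `n` of an infinite sequence. -/
def seqPrefix {α : Type} (S : ℕ → α) (n : ℕ) : Fin n → α := fun i => S i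

/-- The success set of a function on strings. -/
def successSet {α : Type} (d : (n : ℕ) → (Fin n → α) → ℝ≥0) : Set (ℕ → α) :=
  {S | limsup (fun n => (d n (seqPrefix S n) : ℝ≥0∞)) atTop = ⊤}

/-- The strong success set of a function on strings. -/
def strongSuccessSet {α : Type} (d : (n : ℕ) → (Fin n → α) → ℝ≥0) : Set (ℕ → α) :=
  {S | liminf (fun n => (d n (seqPrefix S n) : ℝ≥0∞)) atTop = ⊤}

/-- The `h`-head finite-state predimension of a set of sequences. -/
noncomputable def predim (h : ℕ) {α : Type} [Fintype α] [Nontrivial α] (X : Set (ℕ → α)) : ℝ :=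
  sInf {s : ℝ | 0 ≤ s ∧ ∃ G : HeadGambler h α, X ⊆ successSet (G.gale s)}

/-- The `h`-head finite-state strong predimension of a set of sequences. -/
noncomputable def strongPredim (h : ℕ) {α : Type} [Fintype α] [Nontrivial α]
    (X : Set (ℕ → α)) : ℝ :=
  sInf {s : ℝ | 0 ≤ s ∧ ∃ G : HeadGambler h α, X ⊆ strongSuccessSet (G.gale s)}

/-- The `h`-head finite-state predimension of a sequence. -/
noncomputable def seqPredim (h : ℕ) {α : Type} [Fintype α] [Nontrivial α] (S : ℕ → α) : ℝ :=
  predim h {S}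

/-- The `h`-head finite-state strong predimension of a sequence. -/
noncomputable def seqStrongPredim (h : ℕ) {α : Type} [Fintype α] [Nontrivial α]
    (S : ℕ → α) : ℝ :=
  strongPredim h {S}

/-- A prefix machine: a partial computable function of a program `π` and an auxiliary input `τ`
such that, for each `τ`, the set of programs on which it halts is prefix-free. -/
def IsPrefixMachine (M : List Bool → List Bool →. List Bool) : Prop :=
  Partrec₂ M ∧ ∀ τ π π', (M π τ).Dom → (M π' τ).Dom → π <+: π' → π = π'

/-- A universal prefix machine: it simulates each prefix machine with programs that are longer
by at most a constant. -/
def IsUniversalPrefixMachine (U : List Bool → List Bool →. List Bool) : Prop :=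
  IsPrefixMachine U ∧ ∀ M, IsPrefixMachine M → ∃ c : ℕ, ∀ π τ σ, σ ∈ M π τ →
    ∃ π', σ ∈ U π' τ ∧ π'.length ≤ π.length + c

/-- The conditional prefix Kolmogorov complexity of `σ` given `τ` with respect to `U`
(`⊤` if no program outputs `σ`, which does not happen for universal `U`). -/
noncomputable def prefixComplexity (U : List Bool → List Bool →. List Bool)
    (σ τ : List Bool) : ℕ∞ :=
  ⨅ (π : List Bool) (_ : σ ∈ U π τ), (π.length : ℕ∞)

/-- `R` is Martin-Löf random: `K(R[0..n-1]) ≥ n - c` for some `c` and all `n`, where `K` is taken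
with respect to a universal prefix machine (the choice of which does not matter). -/
def IsMLRandom (R : ℕ → Bool) : Prop :=
  ∃ U, IsUniversalPrefixMachine U ∧
    ∃ c : ℕ, ∀ n : ℕ, (n : ℕ∞) ≤ prefixComplexity U (List.ofFn (seqPrefix R n)) [] + c

/-- The `i`-th prime number, counted from `1`: `pr 1 = 2`, `pr 2 = 3`, and so on. -/
noncomputable def pr (i : ℕ) : ℕ := Nat.nth Nat.Prime (i - 1)

theorem pr_lt_pr {k h : ℕ} (hk : k < h) : pr (k + 1) < pr (h + 1) :=
  Nat.nth_strictMono Nat.infinite_setOfPred_prime hk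

/-- The map `F_{h+1}` on binary sequences: for `0 < m = q * p_{h+1} + r` with `r < p_{h+1}`, the
bit at `m` is `S[q * (p_{h+1} - 1) + r]` if `r > 0`, and the parity of the bits of the output at
`q * p_1, ..., q * p_h` if `r = 0`; the bit at `0` is `S[0]`. -/
noncomputable def parityMap (h : ℕ) (S : ℕ → Bool) (m : ℕ) : Bool :=
  if hm : m = 0 then S 0
  else if 0 < m % pr (h + 1) then S (m / pr (h + 1) * (pr (h + 1) - 1) + m % pr (h + 1))
  else
    (List.ofFn fun k : Fin h =>
      parityMap h S (m / pr (h + 1) * pr (k + 1))).foldr xor false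
termination_by m
decreasing_by
  have hd : pr (h + 1) ∣ m := Nat.dvd_of_mod_eq_zero (by omega)
  obtain ⟨q, rfl⟩ := hd
  have hp : pr (k + 1) < pr (h + 1) := pr_lt_pr k.isLt
  have h0 : 0 < pr (h + 1) := by omega
  rw [Nat.mul_div_cancel_left _ h0, Nat.mul_comm (pr (h + 1)) q]
  exact Nat.mul_lt_mul_of_pos_left hp
    (Nat.pos_of_ne_zero fun hq => hm (by rw [hq, Nat.mul_zero]))

/-!
Write `p` for the prime `pr (h + 1)`, `F` for the parity map, and `p_1, ..., p_h` for the primes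
less than `p`.

With `h` trailing heads of speeds `p_k / p`, a gambler can predict each bit of `F(R)` at a positive
multiple of `p`. It doubles its capital there (`parityGambler_martingale`), which bounds the strong
predimension by `1 - 1 / p`.

With only `h - 1` trailing heads, the parities look random. The speeds of the trailing heads are
rational (`HeadGambler.exists_speed`). Consider the time during which the leading head is in the
window `[j ^ 3, (j + 1) ^ 3)`; it is so short that each trailing head stays, on a relative scale,
at a fixed fraction of the position of the leading head. Unfolding the recursion, the bit of `F(R)`
at `b * p ^ v` with `p ∤ b` is a sum of free bits at the positions `b * m`, where `m` runs over
monomials of degree `v` in the smaller primes, and the free bit at `b * p_k ^ v` occurs in it for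
each `k`. By unique factorization, a trailing head of speed less than `1` can meet bits that depend
on the latter free bit for one `k` only, so for each `v` some `k` is missed by all of them
(`exists_missed_prime`). Fix all free bits except those at the missed positions of the window. Then
the bits of `F(R)` in the window determine the remaining free bits
(`eq_false_of_parityMap_window`), while what the trailing heads read before the window is fixed
(`parityMap_trailing_eq_false`; a head of speed `1` lags behind by a bounded distance, so it reads
only boundedly many bits before the window). Both hold up to positions divisible by a large power
of `p`, which are so few that their bits can be fixed as well. Hence the gain of the gambler over
the window is that of a martingale on uniformly distributed bits, up to a factor whose exponential
growth rate in the length of the window is as small as desired, and Markov's inequality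
makes an exponential gain improbable
(`HeadGambler.card_gain_parityMap_mul_le`).

The sets of strings that yield such gains are uniformly primitive recursive. If they contained
prefixes of `R` for infinitely many `j`, these prefixes could be described by `j` in unary and an
index in the set, and `R` would not be random (`IsMLRandom.eventually_eq_false`). So no `s`-gale
with `s < 1` succeeds on `F(R)` (`HeadGambler.notMem_successSet_gale`).

For the existence of a random sequence, a universal prefix machine is built by letting a program of
an arbitrary machine halt only if no comparable program has halted by the stage at which it does.
The Kraft inequality then bounds the measure of the sequences that have a compressible prefix
(`exists_isMLRandom`).
-/

/-! ### Strings of low complexity in small sets -/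

/-- The list of all binary strings of length `n`. -/
def binStrings : ℕ → List (List Bool)
  | 0 => [[]]
  | n + 1 => (binStrings n).map (List.cons false) ++ (binStrings n).map (List.cons true)

theorem mem_binStrings {n : ℕ} {σ : List Bool} : σ ∈ binStrings n ↔ σ.length = n := by
  induction n generalizing σ with
  | zero => simp [binStrings]
  | succ n ih =>
    rcases σ with _ | ⟨b, σ⟩
    · simp [binStrings]
    · cases b <;> simp [binStrings, ih]

theorem length_binStrings (n : ℕ) : (binStrings n).length = 2 ^ n := by
  induction n with
  | zero => rfl
  | succ n ih => simp [binStrings, ih, pow_succ]; ring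

theorem nodup_binStrings (n : ℕ) : (binStrings n).Nodup := by
  induction n with
  | zero => simp [binStrings]
  | succ n ih =>
    refine List.Nodup.append (ih.map List.cons_injective) (ih.map List.cons_injective) ?_
    intro σ h₁ h₂
    simp only [List.mem_map] at h₁ h₂
    obtain ⟨_, _, rfl⟩ := h₁
    obtain ⟨_, _, h⟩ := h₂
    simp at h

theorem primrec_binStrings : Primrec binStrings := by
  have : Primrec (Nat.rec [[]] (fun _ L => L.map (List.cons false) ++ L.map (List.cons true)) :
      ℕ → List (List Bool)) := by
    refine Primrec.nat_rec₁ _ ?_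
    have hmap (b : Bool) : Primrec₂ fun (_ : ℕ) (L : List (List Bool)) => L.map (List.cons b) :=
      Primrec.list_map Primrec.snd
        (Primrec.list_cons.comp₂ (Primrec₂.const b) Primrec₂.right)
    exact Primrec.list_append.comp₂ (hmap false) (hmap true)
  refine this.of_eq fun n => ?_
  induction n with
  | zero => rfl
  | succ n ih => simp only [binStrings, ← ih]

theorem primrec_replicate {α : Type*} [Primcodable α] (a : α) :
    Primrec fun n : ℕ => List.replicate n a := by
  have : Primrec (Nat.rec [] (fun _ L => a :: L) : ℕ → List α) :=
    Primrec.nat_rec₁ _ (Primrec.list_cons.comp₂ (Primrec₂.const a) Primrec₂.right)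
  refine this.of_eq fun n => ?_
  induction n with
  | zero => rfl
  | succ n ih => simp only [List.replicate_succ, ← ih]

theorem idxOf_false_replicate (j : ℕ) (s : List Bool) :
    (List.replicate j true ++ false :: s).idxOf false = j := by
  induction j with
  | zero => simp
  | succ j ih => simp [List.replicate_succ, ih]

theorem prefixComplexity_le {U : List Bool → List Bool →. List Bool} {σ τ π : List Bool}
    (h : σ ∈ U π τ) : prefixComplexity U σ τ ≤ π.length :=
  iInf₂_le π h

/-- The programs `1 ^ j 0 s` with `s` of length `k`. -/
def unaryPrograms (j k : ℕ) : List (List Bool) :=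
  (binStrings k).map fun s => List.replicate j true ++ false :: s

theorem idxOf_false_of_mem_unaryPrograms {j k : ℕ} {π : List Bool} (h : π ∈ unaryPrograms j k) :
    π.idxOf false = j := by
  obtain ⟨s, -, rfl⟩ := List.mem_map.1 h
  exact idxOf_false_replicate j s

theorem length_of_mem_unaryPrograms {j k : ℕ} {π : List Bool} (h : π ∈ unaryPrograms j k) :
    π.length = j + 1 + k := by
  obtain ⟨s, hs, rfl⟩ := List.mem_map.1 h
  simp [mem_binStrings.1 hs]
  ring

theorem length_unaryPrograms (j k : ℕ) : (unaryPrograms j k).length = 2 ^ k := by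
  simp [unaryPrograms, length_binStrings]

theorem nodup_unaryPrograms (j k : ℕ) : (unaryPrograms j k).Nodup :=
  (nodup_binStrings k).map fun s t h => by simpa using h

theorem primrec₂_unaryPrograms : Primrec₂ unaryPrograms := by
  refine Primrec.list_map (primrec_binStrings.comp Primrec.snd) ?_
  exact Primrec.list_append.comp₂
    ((primrec_replicate true).comp₂ (Primrec.fst.comp₂ Primrec₂.left))
    (Primrec.list_cons.comp₂ (Primrec₂.const false) Primrec₂.right)

/-- A uniformly primitive recursive family of sets of strings whose `j`-th member has at most
`2 ^ k j` elements, all of length `m j`: each element has a description of length `k j + j`, up to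
a constant. The machine reads `j` in unary and then the index of the string in the `j`-th set. -/
theorem exists_prefixComplexity_le {U : List Bool → List Bool →. List Bool}
    (hU : IsUniversalPrefixMachine U) {P : ℕ → List Bool → Bool} (hP : Primrec₂ P)
    {m k : ℕ → ℕ} (hm : Primrec m) (hk : Primrec k)
    (hcard : ∀ j, ((binStrings (m j)).filter (P j)).length ≤ 2 ^ k j) :
    ∃ c : ℕ, ∀ j σ, σ.length = m j → P j σ = true →
      prefixComplexity U σ [] ≤ (k j + j + c : ℕ) := by
  set f : List Bool → Option (List Bool) := fun π =>
    ((binStrings (m (π.idxOf false))).filter (P (π.idxOf false)))[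
      (unaryPrograms (π.idxOf false) (k (π.idxOf false))).idxOf π]? with hf
  have hidx : Primrec fun π : List Bool => π.idxOf false :=
    Primrec.list_idxOf.comp (Primrec.const false) Primrec.id
  have hfilter : Primrec fun j => (binStrings (m j)).filter (P j) := by
    have hrel : PrimrecRel fun (σ : List Bool) (j : ℕ) => P j σ = true :=
      Primrec.eq.comp (hP.comp Primrec.snd Primrec.fst) (Primrec.const true)
    have := hrel.listFilter.comp (primrec_binStrings.comp hm) Primrec.id
    exact this.of_eq fun j => by simp
  have hfp : Primrec f := by
    refine Primrec.list_getElem?.comp (hfilter.comp hidx) ?_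
    convert Primrec.list_idxOf.comp Primrec.id
      (primrec₂_unaryPrograms.comp hidx (hk.comp hidx)) using 2
    congr!
  have hdom : ∀ π, (f π).isSome → π ∈ unaryPrograms (π.idxOf false) (k (π.idxOf false)) := by
    intro π hπ
    rw [← List.idxOf_lt_length_iff, length_unaryPrograms]
    simp only [hf, isSome_getElem?] at hπ
    exact lt_of_lt_of_le (by simpa using hπ) (hcard _)
  have hM : IsPrefixMachine fun π _ => (f π : Part (List Bool)) := by
    refine ⟨(Computable.ofOption (hfp.to_comp.comp Computable.fst)).to₂, ?_⟩
    intro τ π π' h h' hpre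
    have h₁ := hdom π (by simpa using h)
    have h₂ := hdom π' (by simpa using h')
    have hmem : false ∈ π := by
      obtain ⟨s, -, hs⟩ := List.mem_map.1 h₁
      rw [← hs]; simp
    have hidx : π'.idxOf false = π.idxOf false := by
      obtain ⟨t, rfl⟩ := hpre
      exact List.idxOf_append_of_mem hmem
    rw [hidx] at h₂
    refine hpre.eq_of_length ?_
    rw [length_of_mem_unaryPrograms h₁, length_of_mem_unaryPrograms h₂]
  obtain ⟨c, hc⟩ := hU.2 _ hM
  refine ⟨1 + c, fun j σ hσ hPσ => ?_⟩
  have hmem : σ ∈ (binStrings (m j)).filter (P j) := by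
    simp [mem_binStrings, hσ, hPσ]
  obtain ⟨i, hi, rfl⟩ := List.getElem_of_mem hmem
  have hi' : i < (unaryPrograms j (k j)).length := by
    rw [length_unaryPrograms]; exact hi.trans_le (hcard j)
  set π := (unaryPrograms j (k j))[i] with hπ
  have hπmem : π ∈ unaryPrograms j (k j) := List.getElem_mem hi'
  have hfπ : f π = some ((binStrings (m j)).filter (P j))[i] := by
    simp only [hf, idxOf_false_of_mem_unaryPrograms hπmem]
    rw [hπ, (nodup_unaryPrograms j (k j)).idxOf_getElem i hi', List.getElem?_eq_getElem hi]
  obtain ⟨π', hπ', hlen⟩ := hc π [] _ (by simp only [hfπ]; exact Part.mem_some _)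
  refine (prefixComplexity_le hπ').trans ?_
  rw [length_of_mem_unaryPrograms hπmem] at hlen
  exact_mod_cast hlen.trans (by omega)

/-- A Martin-Löf random sequence eventually avoids a uniformly primitive recursive family of
sets of strings if the density of the `j`-th set is at most `4 ^ (-j)`. -/
theorem IsMLRandom.eventually_eq_false {R : ℕ → Bool} (hR : IsMLRandom R)
    {P : ℕ → List Bool → Bool} (hP : Primrec₂ P) {m : ℕ → ℕ} (hm : Primrec m)
    (hcard : ∀ᶠ j in atTop, ((binStrings (m j)).filter (P j)).length * 4 ^ j ≤ 2 ^ m j) :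
    ∀ᶠ j in atTop, P j (List.ofFn (seqPrefix R (m j))) = false := by
  obtain ⟨U, hU, c, hc⟩ := hR
  obtain ⟨J, hJ⟩ := eventually_atTop.1 hcard
  have hP' : Primrec₂ fun j σ => decide (J ≤ j) && P j σ :=
    Primrec.and.comp (Primrec.nat_le.decide.comp (Primrec.const J) Primrec.fst) hP
  have hk : Primrec fun j => m j - 2 * j :=
    Primrec.nat_sub.comp hm (Primrec.nat_mul.comp (Primrec.const 2) Primrec.id)
  obtain ⟨c', hc'⟩ := exists_prefixComplexity_le hU hP' hm hk (by
    intro j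
    by_cases hj : J ≤ j
    · simp only [hj, decide_true, Bool.true_and]
      have h := hJ j hj
      rcases le_total (2 * j) (m j) with h2 | h2
      · have : (2 : ℕ) ^ m j = 2 ^ (m j - 2 * j) * 4 ^ j := by
          rw [show (4 : ℕ) = 2 ^ 2 from rfl, ← pow_mul, ← pow_add]
          congr 1; omega
        rw [this] at h
        exact Nat.le_of_mul_le_mul_right h (by positivity)
      · rw [Nat.sub_eq_zero_of_le h2, pow_zero]
        have : (2 : ℕ) ^ m j ≤ 1 * 4 ^ j := by
          rw [one_mul, show (4 : ℕ) = 2 ^ 2 from rfl, ← pow_mul]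
          exact Nat.pow_le_pow_right (by norm_num) h2
        exact Nat.le_of_mul_le_mul_right (h.trans this) (by positivity)
    · simp [hj])
  filter_upwards [eventually_ge_atTop J, eventually_gt_atTop (c + c')] with j hj hjc
  by_contra hne
  have htrue : P j (List.ofFn (seqPrefix R (m j))) = true := by simpa using hne
  have h1 := hc' j (List.ofFn (seqPrefix R (m j))) (by simp) (by simp [hj, htrue])
  have h2 := (hc (m j)).trans (add_le_add_left h1 _)
  have h3 : m j ≤ m j - 2 * j + j + c' + c := by exact_mod_cast h2
  have hpos : 1 ≤ ((binStrings (m j)).filter (P j)).length :=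
    List.length_pos_of_mem (a := List.ofFn (seqPrefix R (m j))) (by simp [mem_binStrings, htrue])
  have h4 : 4 ^ j ≤ 2 ^ m j := le_trans (Nat.le_mul_of_pos_left _ hpos) (hJ j hj)
  rw [show (4 : ℕ) = 2 ^ 2 from rfl, ← pow_mul] at h4
  have h5 := (Nat.pow_le_pow_iff_right (by norm_num)).1 h4
  omega

/-! ### A universal prefix machine -/

section UniversalMachine

open Nat.Partrec (Code)
open Nat.Partrec.Code (evaln)

/-- The string with index `n` (the empty string if `n` is no index). -/
def stringOfNat (n : ℕ) : List Bool := (Encodable.decode (α := List Bool) n).getD []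

theorem stringOfNat_encode (σ : List Bool) : stringOfNat (Encodable.encode σ) = σ := by
  simp [stringOfNat]

/-- The program `π` halts at stage `s` of the computation of the code `c` with auxiliary input `τ`,
but not before, and no other program that is a prefix or an extension of `π` has halted by then. -/
def HaltsUncontested (c : Code) (π τ : List Bool) (s : ℕ) : Prop :=
  evaln (s - 1) c (Encodable.encode (π, τ)) = none ∧
    (evaln s c (Encodable.encode (π, τ))).isSome ∧
    ∀ n < s, stringOfNat n = π ∨
      (π.take (stringOfNat n).length ≠ stringOfNat n ∧ (stringOfNat n).take π.length ≠ π) ∨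
      evaln s c (Encodable.encode (stringOfNat n, τ)) = none

instance (c : Code) (π τ : List Bool) (s : ℕ) : Decidable (HaltsUncontested c π τ s) :=
  inferInstanceAs (Decidable (_ ∧ _ ∧ _))

theorem HaltsUncontested.evaln_eq_none {c : Code} {π π' τ : List Bool} {s : ℕ}
    (h : HaltsUncontested c π τ s) (hne : π' ≠ π) (hcomp : π' <+: π ∨ π <+: π') :
    evaln s c (Encodable.encode (π', τ)) = none := by
  rcases h' : evaln s c (Encodable.encode (π', τ)) with _ | x
  · rfl
  · have hlt : Encodable.encode (π', τ) < s := Nat.Partrec.Code.evaln_bound (x := x) h'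
    have hle : Encodable.encode π' ≤ Encodable.encode (π', τ) := Nat.left_le_pair _ _
    have := h.2.2 _ (hle.trans_lt hlt)
    rw [stringOfNat_encode, h'] at this
    rcases this with h₁ | ⟨h₁, h₂⟩ | h₁
    · exact absurd h₁ hne
    · rcases hcomp with h₃ | h₃
      · exact absurd (List.prefix_iff_eq_take.1 h₃).symm h₁
      · exact absurd (List.prefix_iff_eq_take.1 h₃).symm h₂
    · cases h₁

/-- Two comparable programs that halt uncontested are equal: at the later of the two stages both
have halted. -/
theorem HaltsUncontested.eq {c : Code} {π π' τ : List Bool} {s s' : ℕ}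
    (h : HaltsUncontested c π τ s) (h' : HaltsUncontested c π' τ s')
    (hcomp : π <+: π' ∨ π' <+: π) : π = π' := by
  by_contra hne
  rcases le_total s s' with hs | hs
  · obtain ⟨x, hx⟩ := Option.isSome_iff_exists.1 h.2.1
    have := Nat.Partrec.Code.evaln_mono hs hx
    rw [h'.evaln_eq_none hne hcomp] at this
    cases this
  · obtain ⟨x, hx⟩ := Option.isSome_iff_exists.1 h'.2.1
    have := Nat.Partrec.Code.evaln_mono hs hx
    rw [h.evaln_eq_none (Ne.symm hne) hcomp.symm] at this
    cases this

/-- One stage of the universal machine: a program `1 ^ e 0 π` simulates the program `π` of the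
`e`-th partial recursive function, provided it halts uncontested. -/
def universalStep (π τ : List Bool) (s : ℕ) : Option (List Bool) :=
  let e := π.idxOf false
  let c := Denumerable.ofNat Code e
  let ρ := π.drop (e + 1)
  if e < π.length ∧ HaltsUncontested c ρ τ s then
    (evaln s c (Encodable.encode (ρ, τ))).bind Encodable.decode
  else none

/-- A universal prefix machine. -/
def universalMachine (π τ : List Bool) : Part (List Bool) :=
  Nat.rfindOpt (universalStep π τ)

theorem primrec_evaln_comp {α : Type*} [Primcodable α] {s : α → ℕ} {c : α → Code}
    {π τ : α → List Bool} (hs : Primrec s) (hc : Primrec c) (hπ : Primrec π) (hτ : Primrec τ) :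
    Primrec fun a => evaln (s a) (c a) (Encodable.encode (π a, τ a)) :=
  Nat.Partrec.Code.primrec_evaln.comp
    ((hs.pair hc).pair (Primrec.encode.comp (hπ.pair hτ)))

theorem primrecPred_haltsUncontested : PrimrecPred fun a : (Code × List Bool) × List Bool × ℕ =>
    HaltsUncontested a.1.1 a.1.2 a.2.1 a.2.2 := by
  have hstr : Primrec stringOfNat :=
    Primrec.option_getD.comp Primrec.decode (Primrec.const [])
  have hc : Primrec fun a : (Code × List Bool) × List Bool × ℕ => a.1.1 :=
    Primrec.fst.comp Primrec.fst
  have hπ : Primrec fun a : (Code × List Bool) × List Bool × ℕ => a.1.2 :=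
    Primrec.snd.comp Primrec.fst
  have hτ : Primrec fun a : (Code × List Bool) × List Bool × ℕ => a.2.1 :=
    Primrec.fst.comp Primrec.snd
  have hs : Primrec fun a : (Code × List Bool) × List Bool × ℕ => a.2.2 :=
    Primrec.snd.comp Primrec.snd
  refine (Primrec.eq.comp
    (primrec_evaln_comp (Primrec.nat_sub.comp hs (Primrec.const 1)) hc hπ hτ)
    (Primrec.const none)).and ((Primrec.eq.comp (Primrec.option_isSome.comp
      (primrec_evaln_comp hs hc hπ hτ)) (Primrec.const true)).and ?_)
  have hR : PrimrecRel fun (n : ℕ) (a : (Code × List Bool) × List Bool × ℕ) =>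
      stringOfNat n = a.1.2 ∨
      (a.1.2.take (stringOfNat n).length ≠ stringOfNat n ∧
        (stringOfNat n).take a.1.2.length ≠ a.1.2) ∨
      evaln a.2.2 a.1.1 (Encodable.encode (stringOfNat n, a.2.1)) = none := by
    have hn : Primrec fun x : ℕ × (Code × List Bool) × List Bool × ℕ => stringOfNat x.1 :=
      hstr.comp Primrec.fst
    have hπ' := hπ.comp (Primrec.snd (α := ℕ))
    refine (Primrec.eq.comp hn hπ').or (((Primrec.eq.comp ?_ hn).not.and
      (Primrec.eq.comp ?_ hπ').not).or (Primrec.eq.comp ?_ (Primrec.const none)))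
    · exact Primrec.list_take.comp (Primrec.list_length.comp hn) hπ'
    · exact Primrec.list_take.comp (Primrec.list_length.comp hπ') hn
    · exact primrec_evaln_comp (hs.comp Primrec.snd) (hc.comp Primrec.snd) hn
        (hτ.comp Primrec.snd)
  exact (hR.forall_mem_list.comp (Primrec.list_range.comp hs) Primrec.id).of_eq fun a => by simp

theorem primrec_universalStep : Primrec fun a : (List Bool × List Bool) × ℕ =>
    universalStep a.1.1 a.1.2 a.2 := by
  have hπ : Primrec fun a : (List Bool × List Bool) × ℕ => a.1.1 :=
    Primrec.fst.comp Primrec.fst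
  have hτ : Primrec fun a : (List Bool × List Bool) × ℕ => a.1.2 :=
    Primrec.snd.comp Primrec.fst
  have he : Primrec fun a : (List Bool × List Bool) × ℕ => a.1.1.idxOf false :=
    Primrec.list_idxOf.comp (Primrec.const false) hπ
  have hc := (Primrec.ofNat Code).comp he
  have hρ : Primrec fun a : (List Bool × List Bool) × ℕ => a.1.1.drop (a.1.1.idxOf false + 1) :=
    Primrec.list_drop.comp (Primrec.succ.comp he) hπ
  refine Primrec.ite ((Primrec.nat_lt.comp he (Primrec.list_length.comp hπ)).and
    (primrecPred_haltsUncontested.comp ((hc.pair hρ).pair (hτ.pair Primrec.snd)))) ?_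
    (Primrec.const none)
  exact Primrec.option_bind (primrec_evaln_comp Primrec.snd hc hρ hτ)
    (Primrec.decode.comp₂ Primrec₂.right)

theorem isPrefixMachine_universalMachine : IsPrefixMachine universalMachine := by
  refine ⟨Partrec.rfindOpt primrec_universalStep.to_comp.to₂, ?_⟩
  intro τ π π' h h' hpre
  obtain ⟨s, a, hs⟩ := Nat.rfindOpt_dom.1 h
  obtain ⟨s', a', hs'⟩ := Nat.rfindOpt_dom.1 h'
  have h₁ : π.idxOf false < π.length ∧
      HaltsUncontested (Denumerable.ofNat Code (π.idxOf false))
        (π.drop (π.idxOf false + 1)) τ s := by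
    by_contra hc
    simp [universalStep, if_neg hc] at hs
  have h₂ : π'.idxOf false < π'.length ∧ HaltsUncontested
      (Denumerable.ofNat Code (π'.idxOf false)) (π'.drop (π'.idxOf false + 1)) τ s' := by
    by_contra hc
    simp [universalStep, if_neg hc] at hs'
  obtain ⟨t, rfl⟩ := hpre
  have hidx : (π ++ t).idxOf false = π.idxOf false :=
    List.idxOf_append_of_mem (List.idxOf_lt_length_iff.1 h₁.1)
  rw [hidx, List.drop_append_of_le_length h₁.1] at h₂
  have := h₁.2.eq h₂.2 (Or.inl (List.prefix_append _ _))
  have ht : t = [] := by simpa using this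
  simp [ht]

theorem isUniversalPrefixMachine_universalMachine :
    IsUniversalPrefixMachine universalMachine := by
  refine ⟨isPrefixMachine_universalMachine, fun M hM => ?_⟩
  obtain ⟨c, hc⟩ := Nat.Partrec.Code.exists_code.1 hM.1
  have heval : ∀ π τ, c.eval (Encodable.encode (π, τ)) = (M π τ).map Encodable.encode := by
    intro π τ
    rw [hc]
    simp
  refine ⟨Encodable.encode c + 1, fun π τ σ hσ => ?_⟩
  refine ⟨List.replicate (Encodable.encode c) true ++ false :: π, ?_, by simp; omega⟩
  have hstep : ∀ s, universalStep (List.replicate (Encodable.encode c) true ++ false :: π) τ s =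
      if HaltsUncontested c π τ s then
        (evaln s c (Encodable.encode (π, τ))).bind Encodable.decode else none := by
    intro s
    simp only [universalStep, idxOf_false_replicate, Denumerable.ofNat_encode]
    have : (List.replicate (Encodable.encode c) true ++ false :: π).drop
        (Encodable.encode c + 1) = π := by
      rw [← List.drop_drop, List.drop_left' (by simp)]; rfl
    rw [this]
    simp
  have hval : ∀ {s x}, x ∈ evaln s c (Encodable.encode (π, τ)) → x = Encodable.encode σ := by
    intro s x hx
    have hx' := Nat.Partrec.Code.evaln_sound hx
    rw [heval] at hx'
    exact Part.mem_unique hx' (Part.mem_map _ hσ)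
  have hex : ∃ s, (evaln s c (Encodable.encode (π, τ))).isSome := by
    obtain ⟨s, hs⟩ := Nat.Partrec.Code.evaln_complete.1
      (show Encodable.encode σ ∈ c.eval (Encodable.encode (π, τ)) by
        rw [heval]; exact Part.mem_map _ hσ)
    exact ⟨s, Option.isSome_iff_exists.2 ⟨_, hs⟩⟩
  classical
  have hfirst := Nat.find_spec hex
  set s := Nat.find hex with hs
  have hpos : 0 < s := by
    rcases Nat.eq_zero_or_pos s with h0 | h0
    · rw [h0] at hfirst; simp [Nat.Partrec.Code.evaln] at hfirst
    · exact h0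
  have hunc : HaltsUncontested c π τ s := by
    refine ⟨?_, hfirst, fun n _ => ?_⟩
    · have := Nat.find_min hex (m := s - 1) (by omega)
      simpa using this
    · by_contra hcon
      push Not at hcon
      obtain ⟨h₁, h₂, h₃⟩ := hcon
      obtain ⟨x, hx⟩ := Option.ne_none_iff_exists'.1 h₃
      have hx' := Nat.Partrec.Code.evaln_sound hx
      rw [heval] at hx'
      obtain ⟨y, hy, -⟩ := (Part.mem_map_iff _).1 hx'
      have hdom := Part.dom_iff_mem.2 ⟨y, hy⟩
      have hdomπ := Part.dom_iff_mem.2 ⟨σ, hσ⟩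
      by_cases h₄ : π.take (stringOfNat n).length = stringOfNat n
      · exact h₁ (hM.2 τ _ _ hdom hdomπ (List.prefix_iff_eq_take.2 h₄.symm))
      · exact h₁ (hM.2 τ _ _ hdomπ hdom (List.prefix_iff_eq_take.2 (h₂ h₄).symm)).symm
  have hdom : (universalMachine
      (List.replicate (Encodable.encode c) true ++ false :: π) τ).Dom := by
    refine Nat.rfindOpt_dom.2 ⟨s, σ, ?_⟩
    obtain ⟨x, hx⟩ := Option.isSome_iff_exists.1 hfirst
    rw [hstep, if_pos hunc, hx, hval hx]
    simp
  obtain ⟨a, ha⟩ := Part.dom_iff_mem.1 hdom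
  obtain ⟨t, ht⟩ := Nat.rfindOpt_spec ha
  rw [hstep] at ht
  split_ifs at ht with hu
  · obtain ⟨x, hx⟩ := Option.isSome_iff_exists.1 hu.2.1
    rw [hx, hval hx] at ht
    simp at ht
    rwa [ht]
  · cases ht

end UniversalMachine

/-! ### Existence of random sequences -/

theorem uniquelyDecodable_of_prefixFree {α : Type*} {S : Set (List α)} (h0 : [] ∉ S)
    (hS : ∀ π ∈ S, ∀ π' ∈ S, π <+: π' → π = π') : InformationTheory.UniquelyDecodable S := by
  intro L₁
  induction L₁ with
  | nil =>
    intro L₂ _ h₂ h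
    rcases L₂ with _ | ⟨w, L₂⟩
    · rfl
    · have hw : w = [] := by simp at h; exact h.1
      exact absurd (hw ▸ h₂ w (by simp)) h0
  | cons v L₁ ih =>
    intro L₂ h₁ h₂ h
    rcases L₂ with _ | ⟨w, L₂⟩
    · have hv : v = [] := by simp at h; exact h.1
      exact absurd (hv ▸ h₁ v (by simp)) h0
    · simp only [List.flatten_cons] at h
      have hv := h₁ v (by simp)
      have hw := h₂ w (by simp)
      have hvw : v = w := by
        rcases List.prefix_or_prefix_of_prefix (List.prefix_append v L₁.flatten)
          (h ▸ List.prefix_append w L₂.flatten) with h' | h'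
        · exact hS _ hv _ hw h'
        · exact (hS _ hw _ hv h').symm
      subst hvw
      rw [ih L₂ (fun u hu => h₁ u (by simp [hu])) (fun u hu => h₂ u (by simp [hu]))
        (List.append_cancel_left h)]

/-- The Kraft inequality for finite prefix-free sets of binary strings. -/
theorem kraft_of_prefixFree {S : Finset (List Bool)}
    (hS : ∀ π ∈ S, ∀ π' ∈ S, π <+: π' → π = π') :
    ∑ π ∈ S, (2⁻¹ : ℝ≥0∞) ^ π.length ≤ 1 := by
  by_cases h0 : [] ∈ S
  · have : S = {[]} := by
      ext π
      simp only [Finset.mem_singleton]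
      exact ⟨fun hπ => (hS _ h0 _ hπ (List.nil_prefix)).symm, fun h => h ▸ h0⟩
    simp [this]
  · have := InformationTheory.kraft_mcmillan_inequality
      (uniquelyDecodable_of_prefixFree (S := (S : Set (List Bool))) (by simpa using h0)
        (by simpa using hS))
    have h2 : ∑ π ∈ S, (2⁻¹ : ℝ≥0∞) ^ π.length =
        ENNReal.ofReal (∑ w ∈ S, (1 / Fintype.card Bool : ℝ) ^ w.length) := by
      rw [ENNReal.ofReal_sum_of_nonneg (fun _ _ => by positivity)]
      refine Finset.sum_congr rfl fun w _ => ?_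
      rw [ENNReal.ofReal_pow (by positivity)]
      congr 1
      simp [ENNReal.ofReal_inv_of_pos]
    rw [h2]
    exact ENNReal.ofReal_le_one.2 this

open Classical in
/-- The sum of the measures of the cylinders of those strings in `B` that extend `σ`. -/
noncomputable def extensionWeight (B : Set (List Bool)) (σ : List Bool) : ℝ≥0∞ :=
  ∑' b, if b ∈ B ∧ σ <+: b then 2⁻¹ ^ b.length else 0

theorem extensionWeight_append_le (B : Set (List Bool)) (σ : List Bool) :
    extensionWeight B (σ ++ [false]) + extensionWeight B (σ ++ [true]) ≤ extensionWeight B σ := by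
  classical
  rw [extensionWeight, extensionWeight, ← ENNReal.tsum_add]
  refine ENNReal.tsum_le_tsum fun b => ?_
  have key : ∀ a : Bool, σ ++ [a] <+: b → σ <+: b := fun a h => (List.prefix_append _ _).trans h
  by_cases hB : b ∈ B
  · by_cases h₁ : σ ++ [false] <+: b
    · have h₂ : ¬ σ ++ [true] <+: b := by
        intro h₂
        obtain ⟨t, rfl⟩ := h₁
        obtain ⟨t', h'⟩ := h₂
        simp at h'
      simp [hB, h₁, h₂, key _ h₁]
    · by_cases h₂ : σ ++ [true] <+: b
      · simp [hB, h₁, h₂, key _ h₂]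
      · simp [h₁, h₂]
  · simp [hB]

/-- If the cylinders of the strings in `B` have total measure less than `1`, then some sequence
has no prefix in `B`: it is built bit by bit so that the weight of the prefix `σ` stays less than
the measure of its cylinder. -/
theorem exists_seq_forall_prefix_notMem {B : Set (List Bool)} (hB : extensionWeight B [] < 1) :
    ∃ R : ℕ → Bool, ∀ n, List.ofFn (seqPrefix R n) ∉ B := by
  classical
  have hstep : ∀ σ, extensionWeight B σ < 2⁻¹ ^ σ.length →
      ∃ b, extensionWeight B (σ ++ [b]) < 2⁻¹ ^ (σ ++ [b]).length := by
    intro σ hσ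
    by_contra! hcon
    have h := (add_le_add (hcon false) (hcon true)).trans (extensionWeight_append_le B σ)
    simp only [List.length_append, List.length_singleton, pow_succ, ← mul_add,
      ENNReal.inv_two_add_inv_two, mul_one] at h
    exact absurd hσ (not_lt.2 h)
  choose! f hf using hstep
  let s : ℕ → List Bool := fun n => Nat.rec [] (fun _ σ => σ ++ [f σ]) n
  have hs : ∀ n, extensionWeight B (s n) < 2⁻¹ ^ (s n).length := by
    intro n
    induction n with
    | zero => simpa [s] using hB
    | succ n ih => exact hf _ ih
  have hprefix : ∀ n, List.ofFn (seqPrefix (fun n => f (s n)) n) = s n := by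
    intro n
    induction n with
    | zero => rfl
    | succ n ih =>
      rw [List.ofFn_succ', List.concat_eq_append]
      change List.ofFn (seqPrefix (fun n => f (s n)) n) ++ [f (s n)] = s n ++ [f (s n)]
      rw [ih]
  refine ⟨fun n => f (s n), fun n hn => ?_⟩
  rw [hprefix] at hn
  refine absurd (hs n) (not_lt.2 ?_)
  refine le_trans ?_ (ENNReal.le_tsum (s n))
  simp [hn]

/-- There is a Martin-Löf random sequence: by the Kraft inequality, the sequences with a prefix
`σ` of complexity less than `|σ| - 1` have measure less than `1`. -/
theorem exists_isMLRandom : ∃ R : ℕ → Bool, IsMLRandom R := by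
  classical
  set U := universalMachine
  have hU : IsUniversalPrefixMachine U := isUniversalPrefixMachine_universalMachine
  set B : Set (List Bool) := {σ | ∃ π, σ ∈ U π [] ∧ π.length + 1 < σ.length} with hBdef
  have hchoose : ∀ σ ∈ B, ∃ π, σ ∈ U π [] ∧ π.length + 1 < σ.length := fun σ h => h
  choose! g hg using hchoose
  have hweight : extensionWeight B [] < 1 := by
    refine lt_of_le_of_lt (b := 2⁻¹) ?_ (by simp)
    rw [extensionWeight, ENNReal.tsum_eq_iSup_sum]
    refine iSup_le fun s => ?_
    rw [← Finset.sum_filter]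
    set s' := s.filter fun b => b ∈ B ∧ [] <+: b with hs'
    have hmem : ∀ b ∈ s', b ∈ B := fun b hb => (Finset.mem_filter.1 hb).2.1
    have hinj : Set.InjOn g s' := by
      intro b hb b' hb' h
      have h₁ := (hg b (hmem b hb)).1
      rw [h] at h₁
      exact Part.mem_unique h₁ (hg b' (hmem b' hb')).1
    have hkraft : ∑ π ∈ s'.image g, (2⁻¹ : ℝ≥0∞) ^ π.length ≤ 1 := by
      refine kraft_of_prefixFree fun π hπ π' hπ' hpre => ?_
      obtain ⟨b, hb, rfl⟩ := Finset.mem_image.1 hπ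
      obtain ⟨b', hb', rfl⟩ := Finset.mem_image.1 hπ'
      exact hU.1.2 [] _ _ (Part.dom_iff_mem.2 ⟨b, (hg b (hmem b hb)).1⟩)
        (Part.dom_iff_mem.2 ⟨b', (hg b' (hmem b' hb')).1⟩) hpre
    rw [Finset.sum_image hinj] at hkraft
    calc ∑ b ∈ s', (2⁻¹ : ℝ≥0∞) ^ b.length
        ≤ ∑ b ∈ s', 2⁻¹ * 2⁻¹ ^ (g b).length := by
          refine Finset.sum_le_sum fun b hb => ?_
          rw [← pow_succ']
          exact pow_le_pow_right_of_le_one' (by simp) (hg b (hmem b hb)).2.le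
      _ = 2⁻¹ * ∑ b ∈ s', 2⁻¹ ^ (g b).length := by rw [Finset.mul_sum]
      _ ≤ 2⁻¹ * 1 := by gcongr
      _ = 2⁻¹ := mul_one _
  obtain ⟨R, hR⟩ := exists_seq_forall_prefix_notMem hweight
  refine ⟨R, U, hU, 1, fun n => ?_⟩
  by_contra! hlt
  refine hR n ?_
  have hne : prefixComplexity U (List.ofFn (seqPrefix R n)) [] < (n : ℕ∞) - 1 :=
    lt_tsub_iff_right.2 (by exact_mod_cast hlt)
  simp only [prefixComplexity, iInf_lt_iff] at hne
  obtain ⟨π, hπ, hlt'⟩ := hne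
  have hlt'' : π.length < n - 1 := by exact_mod_cast hlt'
  exact ⟨π, hπ, by simp; omega⟩

/-! ### The parity map and monomials in the smaller primes -/

theorem prime_pr (k : ℕ) : (pr (k + 1)).Prime := Nat.prime_nth_prime k

theorem pr_succ_injective : Function.Injective fun k => pr (k + 1) :=
  Nat.nth_injective Nat.infinite_setOfPred_prime

theorem foldr_xor_ofFn_xor {n : ℕ} (f g : Fin n → Bool) :
    (List.ofFn fun i => xor (f i) (g i)).foldr xor false =
      xor ((List.ofFn f).foldr xor false) ((List.ofFn g).foldr xor false) := by
  induction n with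
  | zero => rfl
  | succ n ih =>
    simp only [List.ofFn_succ, List.foldr_cons, ih]
    simp only [Bool.xor_assoc, Bool.xor_left_comm]

theorem foldr_xor_ofFn_eq_false {n : ℕ} (f : Fin n → Bool) (hf : ∀ i, f i = false) :
    (List.ofFn f).foldr xor false = false := by
  induction n with
  | zero => rfl
  | succ n ih => rw [List.ofFn_succ, List.foldr_cons, ih _ fun i => hf _, hf]; rfl

theorem foldr_xor_ofFn_eq_single {n : ℕ} (f : Fin n → Bool) (k : Fin n)
    (hf : ∀ i, i ≠ k → f i = false) : (List.ofFn f).foldr xor false = f k := by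
  induction n with
  | zero => exact k.elim0
  | succ n ih =>
    rw [List.ofFn_succ, List.foldr_cons]
    rcases Fin.eq_zero_or_eq_succ k with rfl | ⟨k, rfl⟩
    · rw [foldr_xor_ofFn_eq_false _ fun i => hf _ (Fin.succ_ne_zero i), Bool.xor_false]
    · rw [ih (fun i => f i.succ) k fun i hi => hf _ (by simpa using hi),
        hf 0 (Fin.succ_ne_zero k).symm, Bool.false_xor]

/-- The index of the input bit that the parity map places at position `m`, if `p ∤ m`. -/
def freeIndex (p m : ℕ) : ℕ := m / p * (p - 1) + m % p

theorem freeIndex_le {p : ℕ} (m : ℕ) : freeIndex p m ≤ m := by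
  have h₁ : m / p * (p - 1) ≤ m / p * p := Nat.mul_le_mul_left _ (Nat.sub_le _ _)
  have h₂ := Nat.div_add_mod' m p
  unfold freeIndex
  omega

theorem freeIndex_injOn {p m m' : ℕ} (hp : 2 ≤ p) (hm : ¬ p ∣ m) (hm' : ¬ p ∣ m')
    (h : freeIndex p m = freeIndex p m') : m = m' := by
  have hr : 0 < m % p := Nat.pos_of_ne_zero fun h => hm (Nat.dvd_of_mod_eq_zero h)
  have hr' : 0 < m' % p := Nat.pos_of_ne_zero fun h => hm' (Nat.dvd_of_mod_eq_zero h)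
  have hl := Nat.mod_lt m (show 0 < p by omega)
  have hl' := Nat.mod_lt m' (show 0 < p by omega)
  -- Subtracting one makes the remainders range over `0, ..., p - 2`.
  have key : ∀ q r, r < p → 0 < r → (q * (p - 1) + r - 1) / (p - 1) = q ∧
      (q * (p - 1) + r - 1) % (p - 1) = r - 1 := by
    intro q r hr h0
    have : q * (p - 1) + r - 1 = (r - 1) + (p - 1) * q := by rw [mul_comm q]; omega
    rw [this, Nat.add_mul_div_left _ _ (by omega), Nat.add_mul_mod_self_left,
      Nat.div_eq_of_lt (by omega), Nat.mod_eq_of_lt (by omega)]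
    simp
  have k₁ := key (m / p) (m % p) hl hr
  have k₂ := key (m' / p) (m' % p) hl' hr'
  unfold freeIndex at h
  rw [h] at k₁
  have hq : m / p = m' / p := k₁.1.symm.trans k₂.1
  have hm : m % p = m' % p := by have := k₁.2.symm.trans k₂.2; omega
  rw [← Nat.div_add_mod' m p, ← Nat.div_add_mod' m' p, hq, hm]

section parityMap

variable {h : ℕ} (S : ℕ → Bool)

theorem parityMap_zero : parityMap h S 0 = S 0 := by
  rw [parityMap]; simp

theorem parityMap_of_not_dvd {m : ℕ} (hm : ¬ pr (h + 1) ∣ m) :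
    parityMap h S m = S (freeIndex (pr (h + 1)) m) := by
  have h0 : m ≠ 0 := fun h0 => hm (h0 ▸ dvd_zero _)
  rw [parityMap, dif_neg h0, if_pos (Nat.pos_of_ne_zero fun h => hm (Nat.dvd_of_mod_eq_zero h))]
  rfl

theorem parityMap_mul {q : ℕ} (hq : 0 < q) : parityMap h S (q * pr (h + 1)) =
    (List.ofFn fun k : Fin h => parityMap h S (q * pr (k + 1))).foldr xor false := by
  have hp := (prime_pr h).pos
  rw [parityMap, dif_neg (by positivity), if_neg (by simp), Nat.mul_div_cancel _ hp]

end parityMap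

/-- Induction along the recursion that defines the parity map. -/
theorem parityMap_induction {h : ℕ} {C : ℕ → Prop} (h0 : C 0)
    (hfree : ∀ m, ¬ pr (h + 1) ∣ m → C m)
    (hmul : ∀ q, 0 < q → (∀ k : Fin h, C (q * pr (k + 1))) → C (q * pr (h + 1))) (m : ℕ) : C m := by
  induction m using Nat.strong_induction_on with
  | _ m ih =>
    by_cases hd : pr (h + 1) ∣ m
    · obtain ⟨q, rfl⟩ := hd
      rw [mul_comm] at ih ⊢
      rcases Nat.eq_zero_or_pos q with rfl | hq
      · simpa using h0
      · exact hmul q hq fun k => ih _ (Nat.mul_lt_mul_of_pos_left (pr_lt_pr k.isLt) hq)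
    · exact hfree m hd

theorem parityMap_xor {h : ℕ} (S S' : ℕ → Bool) (m : ℕ) :
    parityMap h (fun n => xor (S n) (S' n)) m = xor (parityMap h S m) (parityMap h S' m) := by
  induction m using parityMap_induction (h := h) with
  | h0 => simp [parityMap_zero]
  | hfree m hm => simp [parityMap_of_not_dvd _ hm]
  | hmul q hq ih => simp only [parityMap_mul _ hq, ih, foldr_xor_ofFn_xor]

/-- The bit at `m` depends on the input bits up to `m` only. -/
theorem parityMap_congr {h : ℕ} {S S' : ℕ → Bool} {m : ℕ} (hS : ∀ n ≤ m, S n = S' n) :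
    parityMap h S m = parityMap h S' m := by
  induction m using parityMap_induction (h := h) with
  | h0 => simp [parityMap_zero, hS]
  | hfree m hm => simp [parityMap_of_not_dvd _ hm, hS _ (freeIndex_le m)]
  | hmul q hq ih =>
    simp only [parityMap_mul _ hq]
    congr 2
    funext k
    exact ih k fun n hn => hS n (hn.trans (Nat.mul_le_mul_left _ (pr_lt_pr k.isLt).le))

/-- `m` is a monomial of degree `u` in the primes less than `p`. -/
def IsMonomial (p u m : ℕ) : Prop :=
  m ≠ 0 ∧ (∀ q, q.Prime → q ∣ m → q < p) ∧ ArithmeticFunction.cardFactors m = u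

namespace IsMonomial

variable {p u v m a : ℕ}

theorem not_dvd (hp : p.Prime) (hm : IsMonomial p u m) : ¬ p ∣ m :=
  fun h => lt_irrefl _ (hm.2.1 p hp h)

theorem mul_prime (ha : a.Prime) (hap : a < p) (hm : IsMonomial p u m) :
    IsMonomial p (u + 1) (a * m) := by
  refine ⟨mul_ne_zero ha.ne_zero hm.1, fun q hq hd => ?_, ?_⟩
  · rcases hq.dvd_mul.1 hd with h | h
    · exact (Nat.prime_dvd_prime_iff_eq hq ha).1 h ▸ hap
    · exact hm.2.1 q hq h
  · rw [ArithmeticFunction.cardFactors_mul ha.ne_zero hm.1,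
      ArithmeticFunction.cardFactors_apply_prime ha, hm.2.2, add_comm]

theorem one : IsMonomial p 0 1 :=
  ⟨one_ne_zero, fun _ hq hd => absurd (Nat.dvd_one.1 hd) hq.one_lt.ne', by simp⟩

theorem pow (ha : a.Prime) (hap : a < p) (u : ℕ) : IsMonomial p u (a ^ u) := by
  induction u with
  | zero => simpa using one
  | succ u ih => rw [pow_succ']; exact ih.mul_prime ha hap

theorem of_pow_mul (ha : a.Prime) (hm : IsMonomial p u (a ^ v * m)) :
    v ≤ u ∧ IsMonomial p (u - v) m := by
  have hm0 : m ≠ 0 := fun h => hm.1 (by simp [h])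
  have := hm.2.2
  rw [ArithmeticFunction.cardFactors_mul (pow_ne_zero _ ha.ne_zero) hm0,
    ArithmeticFunction.cardFactors_apply_prime_pow ha] at this
  exact ⟨by omega, hm0, fun q hq hd => hm.2.1 q hq (hd.mul_left _), by omega⟩

theorem le_pow (hm : IsMonomial p u m) : m ≤ p ^ u := by
  rw [← Nat.prod_primeFactorsList hm.1, ← hm.2.2, ArithmeticFunction.cardFactors_apply]
  refine List.prod_le_pow_card _ _ fun q hq => ?_
  exact (hm.2.1 q (Nat.prime_of_mem_primeFactorsList hq)
    (Nat.dvd_of_mem_primeFactorsList hq)).le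

end IsMonomial

/-- The exponent of `p` can be read off from a product of a power of `p` with a number prime
to `p`. -/
theorem eq_of_mul_pow_eq_mul_pow {p u v m n : ℕ} (hp : p.Prime) (hm : ¬ p ∣ m) (hn : ¬ p ∣ n)
    (h : m * p ^ u = n * p ^ v) : u = v ∧ m = n := by
  have hle : ∀ {u v m n : ℕ}, ¬ p ∣ m → m * p ^ u = n * p ^ v → v ≤ u := by
    intro u v m n hm h
    by_contra! hlt
    obtain ⟨d, rfl⟩ := Nat.exists_eq_add_of_lt hlt
    refine hm ⟨n * p ^ d, Nat.eq_of_mul_eq_mul_right (pow_pos hp.pos u) ?_⟩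
    rw [h]; ring
  have huv : u = v := le_antisymm (hle hn h.symm) (hle hm h)
  subst huv
  exact ⟨rfl, Nat.eq_of_mul_eq_mul_right (pow_pos hp.pos u) h⟩

/-- The bit at `b * p ^ u` is the sum of the free bits at `b * m` for the monomials `m` of degree
`u`, with multinomial coefficients; the coefficient of the pure power of a prime is `1`. -/
theorem parityMap_mul_pow {h : ℕ} (δ : ℕ → Bool) (k : Fin h) {u b : ℕ} (hb : ¬ pr (h + 1) ∣ b)
    (hδ : ∀ m, IsMonomial (pr (h + 1)) u m → m ≠ pr (k + 1) ^ u →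
      δ (freeIndex (pr (h + 1)) (b * m)) = false) :
    parityMap h δ (b * pr (h + 1) ^ u) = δ (freeIndex (pr (h + 1)) (b * pr (k + 1) ^ u)) := by
  induction u generalizing b with
  | zero => simpa using parityMap_of_not_dvd δ hb
  | succ u ih =>
    have hb0 : 0 < b := Nat.pos_of_ne_zero fun h0 => hb (h0 ▸ dvd_zero _)
    have hp := prime_pr h
    have ih' : ∀ j : Fin h, parityMap h δ (b * pr (h + 1) ^ u * pr (j + 1)) =
        δ (freeIndex (pr (h + 1)) (b * (pr (j + 1) * pr (k + 1) ^ u))) := by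
      intro j
      have hj := prime_pr j
      have hjp := pr_lt_pr j.isLt
      rw [mul_right_comm, ih, mul_assoc]
      · intro hd
        rcases hp.dvd_mul.1 hd with hd | hd
        · exact hb hd
        · exact hjp.not_ge (Nat.le_of_dvd hj.pos hd)
      · intro m hm hne
        rw [mul_assoc]
        refine hδ _ (hm.mul_prime hj hjp) fun heq => ?_
        -- If `p_j m = p_k ^ (u + 1)` then `j = k`.
        have hjk : pr (j + 1) = pr (k + 1) :=
          (Nat.prime_dvd_prime_iff_eq hj (prime_pr k)).1
            (hj.dvd_of_dvd_pow (heq ▸ dvd_mul_right _ _))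
        rw [hjk, pow_succ'] at heq
        exact hne (Nat.eq_of_mul_eq_mul_left (prime_pr k).pos heq)
    rw [pow_succ, ← mul_assoc, parityMap_mul _ (Nat.mul_pos hb0 (pow_pos hp.pos u)),
      foldr_xor_ofFn_eq_single _ k, ih', ← pow_succ']
    intro j hjk
    rw [ih']
    refine hδ _ ((IsMonomial.pow (prime_pr k) (pr_lt_pr k.isLt) u).mul_prime (prime_pr j)
      (pr_lt_pr j.isLt)) fun heq => hjk ?_
    rw [pow_succ'] at heq
    exact Fin.ext (pr_succ_injective (Nat.eq_of_mul_eq_mul_right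
      (pow_pos (prime_pr k).pos u) heq))

/-- With fewer than `h` trailing heads, of speeds `A i / D`, some prime `p_k` is missed at level
`v`: no position at which a head of speed less than `1` can meet the free bits that enter the
parity bit `b * p ^ u` is proportional to the free position `x * p_k ^ v / p ^ v`.
A head that met these positions for two primes `p_k` would have speed at least `1`. -/
theorem exists_missed_prime {h r : ℕ} (hr : r < h) (A : Fin r → ℕ) (D v : ℕ) :
    ∃ k : Fin h, ∀ i, A i < D → ∀ u m, IsMonomial (pr (h + 1)) u m →
      A i * m * pr (h + 1) ^ v ≠ D * pr (k + 1) ^ v * pr (h + 1) ^ u := by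
  by_contra! hcon
  choose f hf u m hm heq using hcon
  obtain ⟨k, k', hne, hfk⟩ : ∃ k k', k ≠ k' ∧ f k = f k' := by
    have : ¬ Function.Injective f := fun hinj => by
      have := Fintype.card_le_of_injective f hinj
      simp at this; omega
    simpa [Function.Injective, and_comm] using this
  have hp := prime_pr h
  have hk := prime_pr k
  have hk' := prime_pr k'
  have hkp := pr_lt_pr k.isLt
  have hkp' := pr_lt_pr k'.isLt
  have e := heq k
  have e' := heq k'
  rw [← hfk] at e'
  have hAD := hf k
  set p := pr (h + 1)
  set a := pr (k + 1)
  set a' := pr (k' + 1)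
  set α := A (f k)
  have hD : 0 < D := by omega
  have hα : 0 < α := Nat.pos_of_ne_zero fun h0 => by
    rw [h0] at e
    have : 0 < D * a ^ v * p ^ u k :=
      Nat.mul_pos (Nat.mul_pos hD (pow_pos hk.pos v)) (pow_pos hp.pos _)
    omega
  have hcross : (m k * a' ^ v) * p ^ u k' = (m k' * a ^ v) * p ^ u k := by
    have hpos : 0 < α * p ^ v * D := by have := pow_pos hp.pos v; positivity
    refine Nat.eq_of_mul_eq_mul_left hpos ?_
    calc α * p ^ v * D * ((m k * a' ^ v) * p ^ u k')
        = (α * m k * p ^ v) * (D * a' ^ v * p ^ u k') := by ring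
      _ = (D * a ^ v * p ^ u k) * (α * m k' * p ^ v) := by rw [e, e']
      _ = _ := by ring
  have hndvd : ∀ {n c : ℕ}, ¬ p ∣ n → c.Prime → c < p → ¬ p ∣ n * c ^ v := by
    intro n c hn hc hcp hd
    rcases hp.dvd_mul.1 hd with hd | hd
    · exact hn hd
    · exact hcp.not_ge (Nat.le_of_dvd hc.pos (hp.dvd_of_dvd_pow hd))
  obtain ⟨-, hmm⟩ := eq_of_mul_pow_eq_mul_pow hp (hndvd ((hm k).not_dvd hp) hk' hkp')
    (hndvd ((hm k').not_dvd hp) hk hkp) hcross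
  have hdvd : a ^ v ∣ m k := by
    have hcop : (a ^ v).Coprime (a' ^ v) :=
      Nat.Coprime.pow _ _ ((Nat.coprime_primes hk hk').2 fun h =>
        hne (Fin.ext (pr_succ_injective h)))
    exact hcop.dvd_of_dvd_mul_right (hmm ▸ dvd_mul_left _ _)
  obtain ⟨n, hn⟩ := hdvd
  have hmk := hm k
  rw [hn] at hmk e
  obtain ⟨hvu, hmon⟩ := hmk.of_pow_mul hk
  have e₂ : α * (n * p ^ v) = D * p ^ u k := by
    refine Nat.eq_of_mul_eq_mul_left (pow_pos hk.pos v) ?_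
    calc a ^ v * (α * (n * p ^ v)) = α * (a ^ v * n) * p ^ v := by ring
      _ = _ := by rw [e]; ring
  have hle : n * p ^ v ≤ p ^ u k := by
    calc n * p ^ v ≤ p ^ (u k - v) * p ^ v := Nat.mul_le_mul_right _ hmon.le_pow
      _ = p ^ u k := by rw [← pow_add, Nat.sub_add_cancel hvu]
  have : α * (n * p ^ v) < D * p ^ u k :=
    (Nat.mul_le_mul_left _ hle).trans_lt (Nat.mul_lt_mul_of_pos_right hAD (pow_pos hp.pos _))
  omega

/-! ### Missed positions of a window -/

/-- Positions in a window `[j ^ 3, (j + 1) ^ 3)` scaled by different factors stay apart. -/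
theorem eq_of_scaled_close {E F B C j x x' : ℕ} (hE : E ≤ B) (hF : F ≤ B)
    (hx : j ^ 3 ≤ x) (hx₂ : x < (j + 1) ^ 3) (hx' : j ^ 3 ≤ x') (hx'₂ : x' < (j + 1) ^ 3)
    (h₁ : E * x ≤ F * x' + C) (h₂ : F * x' ≤ E * x + C) (hj : 7 * B + C < j) : E = F := by
  have aux : ∀ {E F x x' : ℕ}, E ≤ B → x < (j + 1) ^ 3 → j ^ 3 ≤ x' →
      F * x' ≤ E * x + C → F ≤ E := by
    intro E F x x' hE hx hx' h
    by_contra! hlt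
    have i₁ : (E + 1) * j ^ 3 ≤ F * x' := Nat.mul_le_mul hlt hx'
    have i₂ : E * x ≤ E * (j + 1) ^ 3 := Nat.mul_le_mul_left _ hx.le
    have i₃ : j ^ 3 ≤ E * (3 * j ^ 2 + 3 * j + 1) + C := by nlinarith
    have hj1 : 1 ≤ j := by omega
    have i₄ : 3 * j ^ 2 + 3 * j + 1 ≤ 7 * j ^ 2 := by nlinarith
    have i₅ : E * (3 * j ^ 2 + 3 * j + 1) ≤ B * (7 * j ^ 2) := Nat.mul_le_mul hE i₄
    have i₆ : C ≤ C * j ^ 2 := Nat.le_mul_of_pos_right _ (by positivity)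
    have i₇ : j * j ^ 2 ≤ (7 * B + C) * j ^ 2 := by nlinarith
    have := Nat.le_of_mul_le_mul_right i₇ (by positivity)
    omega
  exact le_antisymm (aux hF hx'₂ hx h₁) (aux hE hx₂ hx' h₂)

section Missed

variable {h : ℕ} (κ : ℕ → Fin h)

/-- For `x = b * p ^ v` with `p ∤ b`, the free position `b * p_k ^ v`, where the prime `p_k` is
chosen by `κ` as a function of the exponent `v`. -/
noncomputable def missedPosition (x : ℕ) : ℕ :=
  x / pr (h + 1) ^ x.factorization (pr (h + 1)) *
    pr (κ (x.factorization (pr (h + 1))) + 1) ^ x.factorization (pr (h + 1))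

theorem div_pow_factorization_mul (p x : ℕ) :
    x / p ^ x.factorization p * p ^ x.factorization p = x :=
  Nat.div_mul_cancel (Nat.ordProj_dvd x p)

theorem factorization_lt_of_not_dvd {p V x : ℕ} (hx : ¬ p ^ V ∣ x) : x.factorization p < V := by
  by_contra! hV
  exact hx ((pow_dvd_pow p hV).trans (Nat.ordProj_dvd x p))

theorem ne_zero_of_not_dvd {d x : ℕ} (hx : ¬ d ∣ x) : x ≠ 0 :=
  fun h0 => hx (h0 ▸ dvd_zero _)

theorem not_dvd_mul_monomial {p u m b : ℕ} (hp : p.Prime) (hb : ¬ p ∣ b)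
    (hm : IsMonomial p u m) : ¬ p ∣ b * m :=
  fun hd => (hp.dvd_mul.1 hd).elim hb (hm.not_dvd hp)

theorem isMonomial_missed (v : ℕ) : IsMonomial (pr (h + 1)) v (pr (κ v + 1) ^ v) :=
  IsMonomial.pow (prime_pr _) (pr_lt_pr (κ v).isLt) v

theorem missedPosition_not_dvd {x : ℕ} (hx : x ≠ 0) : ¬ pr (h + 1) ∣ missedPosition κ x :=
  not_dvd_mul_monomial (prime_pr h) (Nat.not_dvd_ordCompl (prime_pr h) hx)
    (isMonomial_missed κ _)

theorem missedPosition_le (x : ℕ) : missedPosition κ x ≤ x := by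
  conv_rhs => rw [← div_pow_factorization_mul (pr (h + 1)) x]
  exact Nat.mul_le_mul_left _ (isMonomial_missed κ _).le_pow

theorem missedPosition_mul_pow (x : ℕ) :
    missedPosition κ x * pr (h + 1) ^ x.factorization (pr (h + 1)) =
      x * pr (κ (x.factorization (pr (h + 1))) + 1) ^ x.factorization (pr (h + 1)) := by
  conv_rhs => lhs; rw [← div_pow_factorization_mul (pr (h + 1)) x]
  rw [missedPosition]; ring

variable {V j : ℕ}

/-- For a late enough window, the missed position of `x'` in the window enters the parity bit at
`x` only as the pure power that defines the missed position of `x`. -/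
theorem eq_of_mul_eq_missedPosition {x x' m : ℕ} (hj : 7 * pr (h + 1) ^ (2 * V) < j)
    (hx : j ^ 3 ≤ x) (hx₂ : x < (j + 1) ^ 3) (hx' : j ^ 3 ≤ x') (hx'₂ : x' < (j + 1) ^ 3)
    (hV : ¬ pr (h + 1) ^ V ∣ x) (hV' : ¬ pr (h + 1) ^ V ∣ x')
    (hm : IsMonomial (pr (h + 1)) (x.factorization (pr (h + 1))) m)
    (heq : x / pr (h + 1) ^ x.factorization (pr (h + 1)) * m = missedPosition κ x') :
    x.factorization (pr (h + 1)) = x'.factorization (pr (h + 1)) ∧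
      m = pr (κ (x'.factorization (pr (h + 1))) + 1) ^ x'.factorization (pr (h + 1)) := by
  have hp := prime_pr h
  have hv := factorization_lt_of_not_dvd hV
  have hv' := factorization_lt_of_not_dvd hV'
  have hmon' := isMonomial_missed κ (x'.factorization (pr (h + 1)))
  have e₁ := div_pow_factorization_mul (pr (h + 1)) x
  have e₂ := missedPosition_mul_pow κ x'
  set p := pr (h + 1)
  set v := x.factorization p
  set v' := x'.factorization p
  set a := pr (κ v' + 1) ^ v'
  set b := x / p ^ v
  have hcross : (m * p ^ v') * x = (a * p ^ v) * x' := by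
    calc (m * p ^ v') * x = (m * p ^ v') * (b * p ^ v) := by rw [e₁]
      _ = (b * m) * p ^ v' * p ^ v := by ring
      _ = _ := by rw [heq, e₂]; ring
  have hbound : ∀ {s t c : ℕ}, s < V → t < V → c ≤ p ^ s → c * p ^ t ≤ p ^ (2 * V) := by
    intro s t c hs ht hc
    calc c * p ^ t ≤ p ^ s * p ^ t := Nat.mul_le_mul_right _ hc
      _ = p ^ (s + t) := (pow_add _ _ _).symm
      _ ≤ p ^ (2 * V) := Nat.pow_le_pow_right hp.pos (by omega)
  have hEF := eq_of_scaled_close (C := 0) (hbound hv hv' hm.le_pow)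
    (hbound hv' hv hmon'.le_pow) hx hx₂ hx' hx'₂ (by omega) (by omega) (by omega)
  obtain ⟨h₁, h₂⟩ := eq_of_mul_pow_eq_mul_pow hp (hm.not_dvd hp) (hmon'.not_dvd hp) hEF
  exact ⟨h₁.symm, h₂⟩

/-- The indices of the input bits at the missed positions of a window. -/
noncomputable def missedIndices (V j : ℕ) : Finset ℕ :=
  ((Finset.Ico (j ^ 3) ((j + 1) ^ 3)).filter fun x => ¬ pr (h + 1) ^ V ∣ x).image
    fun x => freeIndex (pr (h + 1)) (missedPosition κ x)

theorem missedIndices_lt {i : ℕ} (hi : i ∈ missedIndices κ V j) : i < (j + 1) ^ 3 := by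
  simp only [missedIndices, Finset.mem_image, Finset.mem_filter, Finset.mem_Ico] at hi
  obtain ⟨x, ⟨⟨-, hx⟩, -⟩, rfl⟩ := hi
  exact (freeIndex_le _).trans_lt ((missedPosition_le κ x).trans_lt hx)

theorem card_missedIndices (hj : 7 * pr (h + 1) ^ (2 * V) < j) :
    (missedIndices κ V j).card =
      ((Finset.Ico (j ^ 3) ((j + 1) ^ 3)).filter fun x => ¬ pr (h + 1) ^ V ∣ x).card := by
  refine Finset.card_image_of_injOn fun x hx x' hx' heq => ?_
  simp only [Finset.coe_filter, Finset.mem_Ico, Set.mem_ofPred_eq] at hx hx'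
  have hpos := freeIndex_injOn (prime_pr h).two_le
    (missedPosition_not_dvd κ (ne_zero_of_not_dvd hx.2))
    (missedPosition_not_dvd κ (ne_zero_of_not_dvd hx'.2)) heq
  obtain ⟨hv, hm⟩ := eq_of_mul_eq_missedPosition κ hj hx.1.1 hx.1.2 hx'.1.1 hx'.1.2 hx.2 hx'.2
    (isMonomial_missed κ _) hpos
  have e := missedPosition_mul_pow κ x
  have e' := missedPosition_mul_pow κ x'
  rw [hpos, hv, e'] at e
  exact (Nat.eq_of_mul_eq_mul_right (pow_pos (prime_pr _).pos _) e).symm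

variable {δ : ℕ → Bool} (hδ : ∀ i, i ∉ missedIndices κ V j → δ i = false)
include hδ

theorem exists_of_apply_freeIndex_eq_true {n : ℕ} (hn : ¬ pr (h + 1) ∣ n)
    (htrue : δ (freeIndex (pr (h + 1)) n) = true) :
    ∃ x, j ^ 3 ≤ x ∧ x < (j + 1) ^ 3 ∧ ¬ pr (h + 1) ^ V ∣ x ∧ n = missedPosition κ x := by
  have hmem : freeIndex (pr (h + 1)) n ∈ missedIndices κ V j := by
    by_contra hmem
    rw [hδ _ hmem] at htrue
    cases htrue
  simp only [missedIndices, Finset.mem_image, Finset.mem_filter, Finset.mem_Ico] at hmem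
  obtain ⟨x, ⟨⟨hx, hx₂⟩, hV⟩, heq⟩ := hmem
  exact ⟨x, hx, hx₂, hV, freeIndex_injOn (prime_pr h).two_le hn
    (missedPosition_not_dvd κ (ne_zero_of_not_dvd hV)) heq.symm⟩

/-- A change of the input bits at the missed positions changes the output bit at `x` in the window
according to the input bit at the missed position of `x` alone. -/
theorem parityMap_window_eq (hj : 7 * pr (h + 1) ^ (2 * V) < j) {x : ℕ} (hx : j ^ 3 ≤ x)
    (hx₂ : x < (j + 1) ^ 3) (hV : ¬ pr (h + 1) ^ V ∣ x) :
    parityMap h δ x = δ (freeIndex (pr (h + 1)) (missedPosition κ x)) := by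
  have hb := Nat.not_dvd_ordCompl (prime_pr h) (ne_zero_of_not_dvd hV)
  have := parityMap_mul_pow (u := x.factorization (pr (h + 1))) δ
    (κ (x.factorization (pr (h + 1)))) hb ?_
  · rwa [div_pow_factorization_mul] at this
  · intro m hm hne
    by_contra htrue
    obtain ⟨x', hx', hx'₂, hV', heq⟩ := exists_of_apply_freeIndex_eq_true κ hδ
      (not_dvd_mul_monomial (prime_pr h) hb hm) (by simpa using htrue)
    obtain ⟨hv, hm'⟩ := eq_of_mul_eq_missedPosition κ hj hx hx₂ hx' hx'₂ hV hV' hm heq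
    rw [← hv] at hm'
    exact hne hm'

/-- If the output does not change on the window, then the input does not change at all. -/
theorem eq_false_of_parityMap_window (hj : 7 * pr (h + 1) ^ (2 * V) < j)
    (hW : ∀ x, j ^ 3 ≤ x → x < (j + 1) ^ 3 → parityMap h δ x = false) (i : ℕ) : δ i = false := by
  by_cases hi : i ∈ missedIndices κ V j
  · simp only [missedIndices, Finset.mem_image, Finset.mem_filter, Finset.mem_Ico] at hi
    obtain ⟨x, ⟨⟨hx, hx₂⟩, hV⟩, rfl⟩ := hi
    rw [← parityMap_window_eq κ hδ hj hx hx₂ hV, hW x hx hx₂]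
  · exact hδ i hi

/-- A change of the input bits at the missed positions does not change the output bit at `y`, if
`y` is close to `A / D < 1` times a position `n` of the window and `κ` misses the speed `A / D`. -/
theorem parityMap_trailing_eq_false {A D C n y : ℕ} (hAD : A < D)
    (hj : 7 * (D * pr (h + 1) ^ (2 * V)) + C * pr (h + 1) ^ (2 * V) < j)
    (hκ : ∀ v u m, IsMonomial (pr (h + 1)) u m →
      A * m * pr (h + 1) ^ v ≠ D * pr (κ v + 1) ^ v * pr (h + 1) ^ u)
    (hn : j ^ 3 ≤ n) (hn₂ : n < (j + 1) ^ 3) (h₁ : A * n ≤ D * y + C) (h₂ : D * y ≤ A * n + C)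
    (hV : ¬ pr (h + 1) ^ V ∣ y) : parityMap h δ y = false := by
  have hp := prime_pr h
  have hb := Nat.not_dvd_ordCompl hp (ne_zero_of_not_dvd hV)
  have hzero : ∀ m, IsMonomial (pr (h + 1)) (y.factorization (pr (h + 1))) m →
      δ (freeIndex (pr (h + 1)) (y / pr (h + 1) ^ y.factorization (pr (h + 1)) * m)) = false := by
    intro m hm
    by_contra htrue
    obtain ⟨x, hx, hx₂, hVx, heq⟩ := exists_of_apply_freeIndex_eq_true κ hδ
      (not_dvd_mul_monomial hp hb hm) (by simpa using htrue)
    have hv := factorization_lt_of_not_dvd hVx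
    have hu := factorization_lt_of_not_dvd hV
    have hmon := isMonomial_missed κ (x.factorization (pr (h + 1)))
    have e₁ := div_pow_factorization_mul (pr (h + 1)) y
    have e₂ := missedPosition_mul_pow κ x
    have hne := hκ (x.factorization (pr (h + 1))) _ m hm
    set p := pr (h + 1)
    set v := x.factorization p
    set u := y.factorization p
    set a := pr (κ v + 1) ^ v
    set b := y / p ^ u
    have hcross : m * p ^ v * y = a * p ^ u * x := by
      calc m * p ^ v * y = m * p ^ v * (b * p ^ u) := by rw [e₁]
        _ = (b * m) * p ^ v * p ^ u := by ring
        _ = _ := by rw [heq, e₂]; ring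
    have hbound : ∀ {s t c : ℕ}, s < V → t < V → c ≤ p ^ s → c * p ^ t ≤ p ^ (2 * V) := by
      intro s t c hs ht hc
      calc c * p ^ t ≤ p ^ s * p ^ t := Nat.mul_le_mul_right _ hc
        _ = p ^ (s + t) := (pow_add _ _ _).symm
        _ ≤ p ^ (2 * V) := Nat.pow_le_pow_right hp.pos (by omega)
    have b₁ := hbound hu hv hm.le_pow
    have b₂ := hbound hv hu hmon.le_pow
    refine hne ?_
    have hE : A * (m * p ^ v) ≤ D * p ^ (2 * V) := Nat.mul_le_mul hAD.le b₁
    have hF : D * (a * p ^ u) ≤ D * p ^ (2 * V) := Nat.mul_le_mul_left _ b₂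
    have hC : C * (m * p ^ v) ≤ C * p ^ (2 * V) := Nat.mul_le_mul_left _ b₁
    have i₁ : A * (m * p ^ v) * n ≤ D * (a * p ^ u) * x + C * p ^ (2 * V) := by
      calc A * (m * p ^ v) * n = (A * n) * (m * p ^ v) := by ring
        _ ≤ (D * y + C) * (m * p ^ v) := Nat.mul_le_mul_right _ h₁
        _ = D * (m * p ^ v * y) + C * (m * p ^ v) := by ring
        _ ≤ _ := by rw [hcross, ← mul_assoc D]; exact Nat.add_le_add_left hC _
    have i₂ : D * (a * p ^ u) * x ≤ A * (m * p ^ v) * n + C * p ^ (2 * V) := by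
      calc D * (a * p ^ u) * x = (D * y) * (m * p ^ v) := by rw [mul_assoc, ← hcross]; ring
        _ ≤ (A * n + C) * (m * p ^ v) := Nat.mul_le_mul_right _ h₂
        _ = A * (m * p ^ v) * n + C * (m * p ^ v) := by ring
        _ ≤ _ := Nat.add_le_add_left hC _
    have := eq_of_scaled_close hE hF hn hn₂ hx hx₂ i₁ i₂ hj
    rw [mul_assoc, this]; ring
  have hlast := isMonomial_missed κ (y.factorization (pr (h + 1)))
  have := parityMap_mul_pow (u := y.factorization (pr (h + 1))) δ
    (κ (y.factorization (pr (h + 1)))) hb fun m hm _ => hzero m hm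
  rw [div_pow_factorization_mul] at this
  rw [this, hzero _ hlast]

end Missed

/-! ### Gains of a gambler over a window -/

/-- The sequence that is `z` below `n₀`, continues with the string `w`, and is `false` after. -/
def glue (n₀ : ℕ) (z : ℕ → Bool) {l : ℕ} (w : Fin l → Bool) (x : ℕ) : Bool :=
  if x < n₀ then z x else if hx : x - n₀ < l then w ⟨x - n₀, hx⟩ else false

theorem glue_of_lt {n₀ : ℕ} (z : ℕ → Bool) {l : ℕ} (w : Fin l → Bool) {x : ℕ} (hx : x < n₀) :
    glue n₀ z w x = z x := if_pos hx

theorem glue_add {n₀ : ℕ} (z : ℕ → Bool) {l : ℕ} (w : Fin l → Bool) {t : ℕ} (ht : t < l) :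
    glue n₀ z w (n₀ + t) = w ⟨t, ht⟩ := by
  rw [glue, if_neg (by omega), dif_pos (by omega)]
  congr 2; omega

theorem glue_snoc {n₀ : ℕ} (z : ℕ → Bool) {l : ℕ} (w : Fin l → Bool) (b : Bool) {x : ℕ}
    (hx : x < n₀ + l) :
    glue n₀ z (Fin.snoc (α := fun _ => Bool) w b) x = glue n₀ z w x := by
  rcases lt_or_ge x n₀ with h | h
  · rw [glue_of_lt _ _ h, glue_of_lt _ _ h]
  · obtain ⟨t, rfl⟩ := Nat.exists_eq_add_of_le h
    rw [glue_add _ _ (show t < l + 1 by omega), glue_add _ _ (show t < l by omega)]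
    exact Fin.snoc_castSucc (α := fun _ => Bool) b w ⟨t, by omega⟩

namespace HeadGambler

variable {h : ℕ} (G : HeadGambler h Bool)

/-- The `Q`-state of `G` after `t` further steps on `S`, if it is `q` at time `n₀`. -/
def runState (G : HeadGambler h Bool) (q : G.Q) (n₀ : ℕ) (S : ℕ → Bool) : ℕ → G.Q
  | 0 => q
  | t + 1 => G.stepQ (G.runState q n₀ S t) (fun i => S (G.position (n₀ + t) i)) (S (n₀ + t))

/-- The factor by which the capital of `G` changes from time `n₀` to time `n₀ + l` on `S`, if
its `Q`-state at time `n₀` is `q`. -/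
noncomputable def gain (q : G.Q) (n₀ : ℕ) (S : ℕ → Bool) (l : ℕ) : ℝ≥0 :=
  ∏ t ∈ Finset.range l, 2 * (G.bet (G.runState q n₀ S t) (S (n₀ + t)) : ℝ≥0)

theorem runState_congr {q : G.Q} {n₀ : ℕ} {S S' : ℕ → Bool} {t : ℕ}
    (hS : ∀ s < t, S (n₀ + s) = S' (n₀ + s) ∧
      ∀ i, S (G.position (n₀ + s) i) = S' (G.position (n₀ + s) i)) :
    G.runState q n₀ S t = G.runState q n₀ S' t := by
  induction t with
  | zero => rfl
  | succ t ih =>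
    simp only [runState, ih fun s hs => hS s (by omega), (hS t (by omega)).1,
      (hS t (by omega)).2]

theorem gain_congr {q : G.Q} {n₀ : ℕ} {S S' : ℕ → Bool} {l : ℕ}
    (hS : ∀ s < l, S (n₀ + s) = S' (n₀ + s) ∧
      ∀ i, S (G.position (n₀ + s) i) = S' (G.position (n₀ + s) i)) :
    G.gain q n₀ S l = G.gain q n₀ S' l := by
  refine Finset.prod_congr rfl fun t ht => ?_
  have ht := Finset.mem_range.1 ht
  rw [G.runState_congr fun s hs => hS s (hs.trans ht), (hS t ht).1]

theorem stateQ_add (n₀ : ℕ) (S : ℕ → Bool) (t : ℕ) :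
    G.stateQ (n₀ + t) (seqPrefix S (n₀ + t)) =
      G.runState (G.stateQ n₀ (seqPrefix S n₀)) n₀ S t := by
  induction t with
  | zero => rfl
  | succ t ih =>
    rw [runState, ← ih]
    rfl

theorem martingale_add (n₀ : ℕ) (S : ℕ → Bool) (l : ℕ) :
    G.martingale (n₀ + l) (seqPrefix S (n₀ + l)) =
      G.martingale n₀ (seqPrefix S n₀) * G.gain (G.stateQ n₀ (seqPrefix S n₀)) n₀ S l := by
  induction l with
  | zero => simp [gain]
  | succ l ih =>
    rw [gain, Finset.prod_range_succ, ← gain, ← mul_assoc, ← ih, ← stateQ_add]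
    have : G.martingale (n₀ + (l + 1)) (seqPrefix S (n₀ + (l + 1))) =
      Fintype.card Bool * G.martingale (n₀ + l) (seqPrefix S (n₀ + l)) *
        (G.bet (G.stateQ (n₀ + l) (seqPrefix S (n₀ + l))) (S (n₀ + l)) : ℝ≥0) := rfl
    rw [this, Fintype.card_bool]
    push_cast
    ring

/-- For a fixed past, the gain over the next `l` bits averages to `1`. -/
theorem sum_gain_glue (q : G.Q) (n₀ : ℕ) (z : ℕ → Bool) (l : ℕ) :
    ∑ w : Fin l → Bool, G.gain q n₀ (glue n₀ z w) l = 2 ^ l := by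
  induction l with
  | zero => simp [gain]
  | succ l ih =>
    rw [← (Fin.snocEquiv fun _ : Fin (l + 1) => Bool).sum_comp, Fintype.sum_prod_type_right,
      pow_succ, ← ih, Finset.sum_mul]
    refine Finset.sum_congr rfl fun w _ => ?_
    have hterm : ∀ b : Bool, G.gain q n₀ (glue n₀ z (Fin.snoc (α := fun _ => Bool) w b)) (l + 1) =
        G.gain q n₀ (glue n₀ z w) l * (2 * (G.bet (G.runState q n₀ (glue n₀ z w) l) b : ℝ≥0)) := by
      intro b
      have hcongr : ∀ s < l, glue n₀ z (Fin.snoc (α := fun _ => Bool) w b) (n₀ + s) =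
          glue n₀ z w (n₀ + s) ∧ ∀ i, glue n₀ z (Fin.snoc (α := fun _ => Bool) w b)
            (G.position (n₀ + s) i) = glue n₀ z w (G.position (n₀ + s) i) := by
        refine fun s hs => ⟨glue_snoc _ _ _ (by omega), fun i => glue_snoc _ _ _ ?_⟩
        have := G.position_le (n₀ + s) i
        omega
      rw [gain, Finset.prod_range_succ, ← gain, G.gain_congr hcongr, G.runState_congr hcongr,
        glue_add _ _ (show l < l + 1 by omega)]
      congr 4
      exact Fin.snoc_last (α := fun _ => Bool) b w
    have hsum : (G.bet (G.runState q n₀ (glue n₀ z w) l) true : ℝ≥0) +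
        (G.bet (G.runState q n₀ (glue n₀ z w) l) false : ℝ≥0) = 1 := by
      have := G.bet_sum (G.runState q n₀ (glue n₀ z w) l)
      rw [Fintype.sum_bool] at this
      exact_mod_cast this
    rw [Fintype.sum_bool]
    change G.gain q n₀ (glue n₀ z (Fin.snoc (α := fun _ => Bool) w true)) (l + 1) +
      G.gain q n₀ (glue n₀ z (Fin.snoc (α := fun _ => Bool) w false)) (l + 1) = _
    rw [hterm, hterm, ← mul_add, ← mul_add, hsum, mul_one]

/-- Markov's inequality for the gain. -/
theorem card_le_gain_mul (q : G.Q) (n₀ : ℕ) (z : ℕ → Bool) (l : ℕ) (c : ℝ≥0) :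
    ((Finset.univ.filter fun w : Fin l → Bool => c ≤ G.gain q n₀ (glue n₀ z w) l).card : ℝ≥0) * c
      ≤ 2 ^ l := by
  rw [← G.sum_gain_glue q n₀ z l, ← nsmul_eq_mul]
  refine (Finset.card_nsmul_le_sum _ _ _ fun w hw => (Finset.mem_filter.1 hw).2).trans ?_
  exact Finset.sum_le_sum_of_subset (Finset.filter_subset _ _)

theorem position_add_le (n t : ℕ) (i : Fin (h - 1)) :
    G.position n i ≤ G.position (n + t) i ∧ G.position (n + t) i ≤ G.position n i + t := by
  induction t with
  | zero => simp
  | succ t ih =>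
    have := Bool.toNat_le (G.move (G.stepT^[n + t] G.t₀) i)
    have e : G.position (n + (t + 1)) i =
      G.position (n + t) i + (G.move (G.stepT^[n + t] G.t₀) i).toNat := rfl
    omega

/-- The trailing heads move at rational speeds `A i / D`, up to a bounded error: the sequence of
`T`-states is eventually periodic. -/
theorem exists_speed : ∃ (D C : ℕ) (A : Fin (h - 1) → ℕ), ∀ i, A i ≤ D ∧
    (∀ n, A i * n ≤ D * G.position n i + C ∧ D * G.position n i ≤ A i * n + C) ∧
    (A i = D → ∀ n, n ≤ G.position n i + C) := by
  have := G.finiteT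
  obtain ⟨a, b, hne, hab⟩ := Finite.exists_ne_map_eq_of_infinite fun n => G.stepT^[n] G.t₀
  wlog hlt : a < b generalizing a b
  · exact this b a hne.symm hab.symm (by omega)
  obtain ⟨D, hD, rfl⟩ : ∃ D, 0 < D ∧ b = a + D := ⟨b - a, by omega, by omega⟩
  have hper : ∀ t, G.stepT^[a + D + t] G.t₀ = G.stepT^[a + t] G.t₀ := by
    intro t
    rw [add_comm _ t, add_comm a t, Function.iterate_add_apply, Function.iterate_add_apply _ t a]
    exact congrArg _ hab.symm
  have hpos : ∀ i t, G.position (a + D + t) i =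
      G.position (a + t) i + (G.position (a + D) i - G.position a i) := by
    intro i t
    induction t with
    | zero => have := (G.position_add_le a D i).1; simp; omega
    | succ t ih =>
      have e : ∀ n, G.position (n + (t + 1)) i =
        G.position (n + t) i + (G.move (G.stepT^[n + t] G.t₀) i).toNat := fun n => rfl
      rw [e, e, hper, ih]; omega
  refine ⟨D, D * (a + D), fun i => G.position (a + D) i - G.position a i, fun i => ?_⟩
  have hA := (G.position_add_le a D i).2
  have hpos := hpos i
  set A := G.position (a + D) i - G.position a i
  have hAD : A ≤ D := by omega
  have hspeed : ∀ n, A * n ≤ D * G.position n i + D * (a + D) ∧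
      D * G.position n i ≤ A * n + D * (a + D) := by
    intro n
    induction n using Nat.strong_induction_on with
    | _ n ih =>
      rcases lt_or_ge n (a + D) with hn | hn
      · have h₁ : A * n ≤ D * (a + D) := Nat.mul_le_mul hAD hn.le
        have h₂ : D * G.position n i ≤ D * (a + D) :=
          Nat.mul_le_mul_left _ ((G.position_le n i).trans hn.le)
        omega
      · obtain ⟨t, rfl⟩ := Nat.exists_eq_add_of_le hn
        rw [hpos t]
        have := ih (a + t) (by omega)
        constructor <;> nlinarith
  refine ⟨hAD, hspeed, fun hAeq n => ?_⟩
  have h₁ := (hspeed n).1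
  rw [show A = D from hAeq, ← mul_add] at h₁
  have h₂ := Nat.le_of_mul_le_mul_left h₁ hD
  have h₃ : a + D ≤ D * (a + D) := Nat.le_mul_of_pos_left _ hD
  omega

end HeadGambler

theorem card_filter_dvd_Ico_le (d s l : ℕ) (hd : 0 < d) :
    ((Finset.Ico s (s + l)).filter (d ∣ ·)).card ≤ l / d + 2 := by
  have hmaps : Set.MapsTo (· / d) ((Finset.Ico s (s + l)).filter (d ∣ ·) : Finset ℕ)
      (Finset.Icc (s / d) (s / d + (l / d + 1)) : Finset ℕ) := by
    intro y hy
    simp only [Finset.coe_filter, Finset.mem_Ico, Set.mem_ofPred_eq] at hy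
    simp only [Finset.coe_Icc, Set.mem_Icc]
    refine ⟨Nat.div_le_div_right hy.1.1, ?_⟩
    refine (Nat.div_le_div_right hy.1.2.le).trans ?_
    have h₁ := Nat.div_add_mod s d
    have h₂ := Nat.div_add_mod l d
    have h₃ := Nat.mod_lt s hd
    have h₄ := Nat.mod_lt l hd
    refine Nat.lt_succ_iff.1 (Nat.div_lt_of_lt_mul ?_)
    rw [Nat.succ_eq_add_one]
    have : d * (s / d + (l / d + 1) + 1) = d * (s / d) + d * (l / d) + d + d := by ring
    omega
  refine (Finset.card_le_card_of_injOn _ hmaps ?_).trans (by simp; omega)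
  intro y hy y' hy' heq
  simp only [Finset.coe_filter, Set.mem_ofPred_eq] at hy hy'
  exact (Nat.div_left_inj hy.2 hy'.2).1 heq

/-! ### Large gains on images of the parity map are rare -/

/-- The sequence that starts with the string `τ` and is `false` after. -/
def extendFalse {n : ℕ} (τ : Fin n → Bool) (x : ℕ) : Bool := if hx : x < n then τ ⟨x, hx⟩ else false

namespace HeadGambler

variable {h : ℕ} (G : HeadGambler h Bool)

open Classical in
/-- The positions before the window `[j ^ 3, (j + 1) ^ 3)` that trailing heads read while the
leading head is in the window, and that are multiples of `p ^ V` or read by a head of speed `1`. -/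
noncomputable def exceptionalPositions (A : Fin (h - 1) → ℕ) (D V j : ℕ) : Finset ℕ :=
  (Finset.range (j ^ 3)).filter fun y => ∃ i n, j ^ 3 ≤ n ∧ n < (j + 1) ^ 3 ∧
    G.position n i = y ∧ (pr (h + 1) ^ V ∣ y ∨ A i = D)

theorem card_exceptionalPositions_le {A : Fin (h - 1) → ℕ} {D C : ℕ}
    (hC : ∀ i, A i = D → ∀ n, n ≤ G.position n i + C) (V j : ℕ) :
    (G.exceptionalPositions A D V j).card ≤
      (h - 1) * (C + (((j + 1) ^ 3 - j ^ 3) / pr (h + 1) ^ V + 2)) := by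
  classical
  have hj : j ^ 3 ≤ (j + 1) ^ 3 := Nat.pow_le_pow_left (Nat.le_succ j) 3
  have hsub : G.exceptionalPositions A D V j ⊆ Finset.univ.biUnion fun i : Fin (h - 1) =>
      Finset.Ico (j ^ 3 - C) (j ^ 3) ∪ (Finset.Ico (G.position (j ^ 3) i)
        (G.position (j ^ 3) i + ((j + 1) ^ 3 - j ^ 3))).filter (pr (h + 1) ^ V ∣ ·) := by
    intro y hy
    simp only [exceptionalPositions, Finset.mem_filter, Finset.mem_range] at hy
    obtain ⟨hy, i, n, hn, hn₂, rfl, hcase⟩ := hy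
    simp only [Finset.mem_biUnion, Finset.mem_univ, true_and, Finset.mem_union, Finset.mem_Ico,
      Finset.mem_filter]
    refine ⟨i, ?_⟩
    rcases hcase with hd | hA
    · right
      obtain ⟨t, rfl⟩ := Nat.exists_eq_add_of_le hn
      have := G.position_add_le (j ^ 3) t i
      exact ⟨⟨this.1, by omega⟩, hd⟩
    · left
      have := hC i hA n
      omega
  refine (Finset.card_le_card hsub).trans ?_
  refine (Finset.card_biUnion_le_card_mul _ _ (C + (((j + 1) ^ 3 - j ^ 3) / pr (h + 1) ^ V + 2))
    fun i _ => ?_).trans (by simp)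
  refine (Finset.card_union_le _ _).trans (Nat.add_le_add ?_ ?_)
  · rw [Nat.card_Ico]; omega
  · exact card_filter_dvd_Ico_le _ _ _ (pow_pos (prime_pr h).pos V)

/-- Let `F` be a set of strings that agree off the missed indices, and whose images under the parity
map agree at the exceptional positions and lead to the same state at the beginning of the window.
A string in `F` is determined by the bits of its image in the window, and the trailing heads read
the same bits before the window in all the images. So if all gains are at least `c`, then `F` has
at most as many elements as Markov's inequality allows window contents. -/
theorem card_fiber_le {A : Fin (h - 1) → ℕ} {D C V j : ℕ} (κ : ℕ → Fin h)
    (hAD : ∀ i, A i ≤ D)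
    (hA : ∀ i n, A i * n ≤ D * G.position n i + C ∧ D * G.position n i ≤ A i * n + C)
    (hκ : ∀ v i, A i < D → ∀ u m, IsMonomial (pr (h + 1)) u m →
      A i * m * pr (h + 1) ^ v ≠ D * pr (κ v + 1) ^ v * pr (h + 1) ^ u)
    (hj : 7 * (D * pr (h + 1) ^ (2 * V)) + C * pr (h + 1) ^ (2 * V) < j)
    (hj' : 7 * pr (h + 1) ^ (2 * V) < j)
    (F : Finset (Fin ((j + 1) ^ 3) → Bool)) (q : G.Q) (c : ℝ≥0)
    (hoff : ∀ τ ∈ F, ∀ τ' ∈ F, ∀ i : Fin ((j + 1) ^ 3), (i : ℕ) ∉ missedIndices κ V j → τ i = τ' i)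
    (hexc : ∀ τ ∈ F, ∀ τ' ∈ F, ∀ y ∈ G.exceptionalPositions A D V j,
      parityMap h (extendFalse τ) y = parityMap h (extendFalse τ') y)
    (hgain : ∀ τ ∈ F, c ≤
      G.gain q (j ^ 3) (parityMap h (extendFalse τ)) ((j + 1) ^ 3 - j ^ 3)) :
    (F.card : ℝ≥0) * c ≤ 2 ^ ((j + 1) ^ 3 - j ^ 3) := by
  classical
  rcases F.eq_empty_or_nonempty with rfl | ⟨τ₀, hτ₀⟩
  · simp
  have hjj : j ^ 3 ≤ (j + 1) ^ 3 := Nat.pow_le_pow_left (Nat.le_succ j) 3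
  -- The change between two strings of the set, as an input sequence.
  have hdiff : ∀ τ ∈ F, ∀ τ' ∈ F, ∀ i, i ∉ missedIndices κ V j →
      xor (extendFalse τ i) (extendFalse τ' i) = false := by
    intro τ hτ τ' hτ' i hi
    simp only [extendFalse]
    split_ifs with hlt
    · rw [hoff τ hτ τ' hτ' ⟨i, hlt⟩ hi, Bool.xor_self]
    · rfl
  have hread : ∀ τ ∈ F, ∀ n, j ^ 3 ≤ n → n < (j + 1) ^ 3 → ∀ i, G.position n i < j ^ 3 →
      parityMap h (extendFalse τ) (G.position n i) =
        parityMap h (extendFalse τ₀) (G.position n i) := by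
    intro τ hτ n hn hn₂ i hi
    by_cases hex : G.position n i ∈ G.exceptionalPositions A D V j
    · exact hexc τ hτ τ₀ hτ₀ _ hex
    · have hnot : ¬ (pr (h + 1) ^ V ∣ G.position n i ∨ A i = D) := fun hor => hex (by
        simp only [exceptionalPositions, Finset.mem_filter, Finset.mem_range]
        exact ⟨hi, i, n, hn, hn₂, rfl, hor⟩)
      push Not at hnot
      have hlt : A i < D := lt_of_le_of_ne (hAD i) hnot.2
      have := parityMap_trailing_eq_false κ (hdiff τ hτ τ₀ hτ₀) hlt hj
        (fun v u m hm => hκ v i hlt u m hm) hn hn₂ (hA i n).1 (hA i n).2 hnot.1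
      rw [parityMap_xor] at this
      simpa using this
  set w : (Fin ((j + 1) ^ 3) → Bool) → Fin ((j + 1) ^ 3 - j ^ 3) → Bool :=
    fun τ t => parityMap h (extendFalse τ) (j ^ 3 + t) with hw
  have hinj : Set.InjOn w F := by
    intro τ hτ τ' hτ' heq
    have hzero := eq_false_of_parityMap_window κ (hdiff τ hτ τ' hτ') hj' (by
      intro x hx hx₂
      rw [parityMap_xor]
      have := congrFun heq ⟨x - j ^ 3, by omega⟩
      simp only [hw, Nat.add_sub_cancel' hx] at this
      rw [this, Bool.xor_self])
    funext i
    have := hzero i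
    simpa [extendFalse] using this
  refine le_trans ?_ (G.card_le_gain_mul q (j ^ 3) (parityMap h (extendFalse τ₀))
    ((j + 1) ^ 3 - j ^ 3) c)
  gcongr
  refine Finset.card_le_card_of_injOn w (fun τ hτ => ?_) hinj
  simp only [Finset.coe_filter, Finset.mem_univ, true_and, Set.mem_ofPred_eq]
  refine (hgain τ hτ).trans_eq (G.gain_congr fun s hs => ?_)
  have hsame : ∀ x, j ^ 3 ≤ x → x < (j + 1) ^ 3 → parityMap h (extendFalse τ) x =
      glue (j ^ 3) (parityMap h (extendFalse τ₀)) (w τ) x := by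
    intro x hx hx₂
    obtain ⟨t, rfl⟩ := Nat.exists_eq_add_of_le hx
    rw [glue_add _ _ (by omega)]
  refine ⟨hsame _ (by omega) (by omega), fun i => ?_⟩
  rcases lt_or_ge (G.position (j ^ 3 + s) i) (j ^ 3) with hlt | hge
  · rw [glue_of_lt _ _ hlt]
    exact hread τ hτ _ (by omega) (by omega) i hlt
  · have := G.position_le (j ^ 3 + s) i
    exact hsame _ hge (by omega)

/-- Up to a factor that grows exponentially in the length of the window at a rate of at most
`h / p ^ V`, Markov's inequality holds for the gain of `G` over the window `[j ^ 3, (j + 1) ^ 3)`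
on the image under the parity map of a uniformly distributed string. -/
theorem card_gain_parityMap_mul_le (hh : 1 ≤ h) (V : ℕ) : ∃ b J : ℕ, ∀ j ≥ J, ∀ c : ℝ≥0,
    ((Finset.univ.filter fun τ : Fin ((j + 1) ^ 3) → Bool => c ≤
      G.gain (G.stateQ (j ^ 3) (seqPrefix (parityMap h (extendFalse τ)) (j ^ 3))) (j ^ 3)
        (parityMap h (extendFalse τ)) ((j + 1) ^ 3 - j ^ 3)).card : ℝ≥0) * c ≤
      2 ^ ((j + 1) ^ 3 + h * (((j + 1) ^ 3 - j ^ 3) / pr (h + 1) ^ V) + b) := by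
  classical
  obtain ⟨D, C, A, hspeed⟩ := G.exists_speed
  have hmissed := fun v => exists_missed_prime (h := h) (show h - 1 < h by omega) A D v
  choose κ hκ using hmissed
  have := G.finiteQ
  let _ : Fintype G.Q := Fintype.ofFinite _
  refine ⟨2 + h * (C + 2) + Fintype.card G.Q, 7 * (D * pr (h + 1) ^ (2 * V)) +
    C * pr (h + 1) ^ (2 * V) + 7 * pr (h + 1) ^ (2 * V) + 1, fun j hj c => ?_⟩
  have hjj : j ^ 3 ≤ (j + 1) ^ 3 := Nat.pow_le_pow_left (Nat.le_succ j) 3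
  have hI := card_missedIndices (V := V) (j := j) κ (by omega)
  have hIlt : ∀ i ∈ missedIndices κ V j, i < (j + 1) ^ 3 := fun i => missedIndices_lt κ
  have hE := G.card_exceptionalPositions_le (fun i => (hspeed i).2.2) V j
  have hIcard : (j + 1) ^ 3 - j ^ 3 ≤ (missedIndices κ V j).card +
      (((j + 1) ^ 3 - j ^ 3) / pr (h + 1) ^ V + 2) := by
    have h₁ := Finset.card_filter_add_card_filter_not (s := Finset.Ico (j ^ 3) ((j + 1) ^ 3))
      (pr (h + 1) ^ V ∣ ·)
    have h₂ := card_filter_dvd_Ico_le (pr (h + 1) ^ V) (j ^ 3) ((j + 1) ^ 3 - j ^ 3)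
      (pow_pos (prime_pr h).pos V)
    rw [Nat.add_sub_cancel' hjj] at h₂
    rw [Nat.card_Ico] at h₁
    omega
  set l := (j + 1) ^ 3 - j ^ 3 with hl
  set E := G.exceptionalPositions A D V j
  set I := missedIndices κ V j
  set I' := Finset.range ((j + 1) ^ 3) \ I with hI'
  have hI'card : I'.card = (j + 1) ^ 3 - I.card := by
    rw [hI', Finset.card_sdiff_of_subset fun i hi => Finset.mem_range.2 (hIlt i hi),
      Finset.card_range]
  set S := Finset.univ.filter fun τ : Fin ((j + 1) ^ 3) → Bool => c ≤
      G.gain (G.stateQ (j ^ 3) (seqPrefix (parityMap h (extendFalse τ)) (j ^ 3))) (j ^ 3)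
        (parityMap h (extendFalse τ)) l with hS
  let code : (Fin ((j + 1) ^ 3) → Bool) → (I' → Bool) × G.Q × (E → Bool) := fun τ =>
    (fun i => extendFalse τ i, G.stateQ (j ^ 3) (seqPrefix (parityMap h (extendFalse τ)) (j ^ 3)),
      fun y => parityMap h (extendFalse τ) y)
  have hfiber : ∀ a, ((S.filter fun τ => code τ = a).card : ℝ≥0) * c ≤ 2 ^ l := by
    intro a
    refine G.card_fiber_le (D := D) (C := C) (A := A) κ (fun i => (hspeed i).1)
      (fun i n => (hspeed i).2.1 n) hκ (V := V) (j := j) (by omega) (by omega) _ a.2.1 c ?_ ?_ ?_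
    · intro τ hτ τ' hτ' i hi
      have h₁ := (Finset.mem_filter.1 hτ).2.trans (Finset.mem_filter.1 hτ').2.symm
      have h₂ := congrFun (congrArg Prod.fst h₁) ⟨i, by simp [hI', I, hi]⟩
      simpa [code, extendFalse] using h₂
    · intro τ hτ τ' hτ' y hy
      have h₁ := (Finset.mem_filter.1 hτ).2.trans (Finset.mem_filter.1 hτ').2.symm
      exact congrFun (congrArg (fun a => a.2.2) h₁) ⟨y, hy⟩
    · intro τ hτ
      have h₁ := (Finset.mem_filter.1 hτ).2
      have h₂ := (Finset.mem_filter.1 (Finset.mem_filter.1 hτ).1).2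
      rw [← congrArg (fun a => a.2.1) h₁]
      exact h₂
  have hcard : S.card = ∑ a, (S.filter fun τ => code τ = a).card :=
    Finset.card_eq_sum_card_fiberwise fun _ _ => Finset.mem_coe.2 (Finset.mem_univ _)
  calc (S.card : ℝ≥0) * c = ∑ a, ((S.filter fun τ => code τ = a).card : ℝ≥0) * c := by
        rw [hcard, Nat.cast_sum, Finset.sum_mul]
    _ ≤ ∑ _a : (I' → Bool) × G.Q × (E → Bool), (2 : ℝ≥0) ^ l :=
        Finset.sum_le_sum fun a _ => hfiber a
    _ = ((2 ^ I'.card * (Fintype.card G.Q * 2 ^ E.card) * 2 ^ l : ℕ) : ℝ≥0) := by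
        simp [Fintype.card_prod]
    _ ≤ ((2 ^ ((j + 1) ^ 3 + h * (l / pr (h + 1) ^ V) + (2 + h * (C + 2) + Fintype.card G.Q)) :
          ℕ) : ℝ≥0) := by
        rw [Nat.cast_le]
        calc 2 ^ I'.card * (Fintype.card G.Q * 2 ^ E.card) * 2 ^ l
            ≤ 2 ^ I'.card * (2 ^ Fintype.card G.Q * 2 ^ E.card) * 2 ^ l := by
              gcongr; exact Nat.lt_two_pow_self.le
          _ = 2 ^ (I'.card + (Fintype.card G.Q + E.card) + l) := by simp only [pow_add]
          _ ≤ _ := by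
              refine Nat.pow_le_pow_right (by norm_num) ?_
              have e₁ : (h - 1) * (C + (l / pr (h + 1) ^ V + 2)) + (l / pr (h + 1) ^ V) ≤
                  h * (C + 2) + h * (l / pr (h + 1) ^ V) := by
                obtain ⟨r, rfl⟩ : ∃ r, h = r + 1 := ⟨h - 1, by omega⟩
                simp only [Nat.add_sub_cancel]
                nlinarith
              have e₂ : I.card ≤ (j + 1) ^ 3 := by
                rw [← Finset.card_range ((j + 1) ^ 3)]
                exact Finset.card_le_card fun i hi => Finset.mem_range.2 (hIlt i hi)
              omega
    _ = _ := by push_cast; rfl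

end HeadGambler

/-! ### Primitive recursiveness of the gain test -/

theorem primrec₂_getD_false : Primrec₂ fun (σ : List Bool) (n : ℕ) => σ.getD n false :=
  Primrec.list_getD false

theorem primrec₂_parityMap (h : ℕ) :
    Primrec₂ fun (σ : List Bool) (m : ℕ) => parityMap h (fun n => σ.getD n false) m := by
  let g : List Bool → List Bool → Option Bool := fun σ L =>
    some (if L.length = 0 then σ.getD 0 false
      else if 0 < L.length % pr (h + 1) then
        σ.getD (L.length / pr (h + 1) * (pr (h + 1) - 1) + L.length % pr (h + 1)) false
      else (List.ofFn fun k : Fin h =>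
        L.getD (L.length / pr (h + 1) * pr (k + 1)) false).foldr xor false)
  refine Primrec.nat_strong_rec _ (g := g) ?_ fun σ m => ?_
  · have hlen : Primrec fun a : List Bool × List Bool => a.2.length :=
      Primrec.list_length.comp Primrec.snd
    have hmod := Primrec.nat_mod.comp hlen (Primrec.const (pr (h + 1)))
    have hdiv := Primrec.nat_div.comp hlen (Primrec.const (pr (h + 1)))
    refine Primrec.option_some.comp (Primrec.ite (Primrec.eq.comp hlen (Primrec.const 0))
      (primrec₂_getD_false.comp Primrec.fst (Primrec.const 0))
      (Primrec.ite (Primrec.nat_lt.comp (Primrec.const 0) hmod)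
        (primrec₂_getD_false.comp Primrec.fst
          (Primrec.nat_add.comp (Primrec.nat_mul.comp hdiv (Primrec.const _)) hmod)) ?_))
    refine Primrec.list_foldr (h := fun _ b => xor b.1 b.2) (Primrec.list_ofFn fun k => ?_)
      (Primrec.const false) ((Primrec.dom_finite fun b : Bool × Bool => xor b.1 b.2).comp₂
        Primrec₂.right)
    exact primrec₂_getD_false.comp Primrec.snd (Primrec.nat_mul.comp hdiv (Primrec.const _))
  · have hlen : ((List.range m).map
      (parityMap h fun n => σ.getD n false)).length = m := by simp
    simp only [g, hlen]
    conv_rhs => rw [parityMap]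
    by_cases hm : m = 0
    · rw [if_pos hm, dif_pos hm]
    · rw [if_neg hm, dif_neg hm]
      split_ifs with hr
      · rfl
      · congr 3
        funext k
        have hd : pr (h + 1) ∣ m := Nat.dvd_of_mod_eq_zero (by omega)
        have hlt : m / pr (h + 1) * pr (k + 1) < m := by
          obtain ⟨q, rfl⟩ := hd
          rw [Nat.mul_div_cancel_left _ (prime_pr h).pos, mul_comm (pr (h + 1))]
          exact Nat.mul_lt_mul_of_pos_left (pr_lt_pr k.isLt)
            (Nat.pos_of_ne_zero fun h0 => hm (by simp [h0]))
        rw [List.getD_eq_getElem _ _ (by simpa using hlt)]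
        simp

theorem primrec_pow {α : Type*} [Primcodable α] {f g : α → ℕ} (hf : Primrec f) (hg : Primrec g) :
    Primrec fun a => f a ^ g a :=
  (Primrec₂.unpaired'.1 Nat.Primrec.pow).comp hf hg

theorem primrec_prod_range {α : Type*} [Primcodable α] {f : α → ℕ → ℕ} (hf : Primrec₂ f)
    {l : α → ℕ} (hl : Primrec l) : Primrec fun a => ∏ t ∈ Finset.range (l a), f a t := by
  have := Primrec.nat_rec' (g := fun _ => 1) (h := fun a b => b.2 * f a b.1) hl
    (Primrec.const _) (Primrec.nat_mul.comp (Primrec.snd.comp Primrec.snd)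
      (hf.comp Primrec.fst (Primrec.fst.comp Primrec.snd)))
  refine this.of_eq fun a => ?_
  induction l a with
  | zero => rfl
  | succ n ih => rw [Finset.prod_range_succ, ← ih]

namespace HeadGambler

variable {h : ℕ} (G : HeadGambler h Bool)

theorem primrec_position (i : Fin (h - 1)) : Primrec fun n => G.position n i := by
  have := G.finiteT
  obtain ⟨k, ⟨e⟩⟩ := Finite.exists_equiv_fin G.T
  let _ : Primcodable G.T := Primcodable.ofEquiv (Fin k) e
  have hstate : Primrec fun n : ℕ => G.stepT^[n] G.t₀ :=
    Primrec.nat_iterate Primrec.id (Primrec.const _)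
      ((Primrec.dom_finite G.stepT).comp₂ Primrec₂.right)
  have hmove : Primrec fun n : ℕ => (G.move (G.stepT^[n] G.t₀) i).toNat :=
    (Primrec.dom_finite fun t => (G.move t i).toNat).comp hstate
  have : Primrec (Nat.rec 0 (fun n x => x + (G.move (G.stepT^[n] G.t₀) i).toNat) : ℕ → ℕ) :=
    Primrec.nat_rec₁ _ (Primrec.nat_add.comp Primrec.snd (hmove.comp Primrec.fst))
  refine this.of_eq fun n => ?_
  induction n with
  | zero => rfl
  | succ n ih => simp only [position, ih]

theorem primrec₂_runState [Primcodable G.Q] {Y : List Bool → ℕ → Bool} (hY : Primrec₂ Y) :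
    Primrec₂ fun (σ : List Bool) (n : ℕ) => G.runState G.q₀ 0 (Y σ) n := by
  have := G.finiteQ
  have hstep : Primrec fun a : G.Q × (Fin (h - 1) → Bool) × Bool => G.stepQ a.1 a.2.1 a.2.2 :=
    Primrec.dom_finite _
  have hrec := Primrec.nat_rec' (f := fun a : List Bool × ℕ => a.2) (g := fun _ => G.q₀)
    (h := fun a b => G.stepQ b.2 (fun i => Y a.1 (G.position b.1 i)) (Y a.1 b.1))
    Primrec.snd (Primrec.const _) (by
      have hσ : Primrec fun c : (List Bool × ℕ) × ℕ × G.Q => c.1.1 :=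
        Primrec.fst.comp Primrec.fst
      have hn : Primrec fun c : (List Bool × ℕ) × ℕ × G.Q => c.2.1 :=
        Primrec.fst.comp Primrec.snd
      refine hstep.comp ((Primrec.snd.comp Primrec.snd).pair
        (Primrec.pair ?_ (hY.comp hσ hn)))
      refine Primrec.fin_curry.2 (Primrec₂.swap (Primrec.fin_curry₁.2 fun i => ?_))
      exact hY.comp hσ ((G.primrec_position i).comp hn))
  refine hrec.of_eq fun ⟨σ, n⟩ => ?_
  dsimp only
  induction n with
  | zero => rfl
  | succ n ih => simp only [runState, ih, zero_add]

theorem runState_zero_eq_stateQ (S : ℕ → Bool) (n : ℕ) :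
    G.runState G.q₀ 0 S n = G.stateQ n (seqPrefix S n) := by
  have := G.stateQ_add 0 S n
  rw [zero_add] at this
  exact this.symm

theorem gain_eq_prod (S : ℕ → Bool) (n₀ l : ℕ) :
    G.gain (G.stateQ n₀ (seqPrefix S n₀)) n₀ S l =
      ∏ t ∈ Finset.range l, 2 * (G.bet (G.runState G.q₀ 0 S (n₀ + t)) (S (n₀ + t)) : ℝ≥0) := by
  refine Finset.prod_congr rfl fun t _ => ?_
  rw [runState_zero_eq_stateQ, stateQ_add]

theorem exists_common_denominator : ∃ (N : ℕ) (num : G.Q → Bool → ℕ), 0 < N ∧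
    ∀ q b, (G.bet q b : ℝ≥0) = num q b / N := by
  have := G.finiteQ
  let _ : Fintype G.Q := Fintype.ofFinite _
  set N := ∏ a : G.Q × Bool, (G.bet a.1 a.2).den with hN
  have hpos : 0 < N := Finset.prod_pos fun a _ => (G.bet a.1 a.2).den_pos
  refine ⟨N, fun q b => (G.bet q b).num * (N / (G.bet q b).den), hpos, fun q b => ?_⟩
  obtain ⟨d, hd⟩ : (G.bet q b).den ∣ N :=
    Finset.dvd_prod_of_mem (fun a : G.Q × Bool => (G.bet a.1 a.2).den) (Finset.mem_univ (q, b))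
  have hden := (G.bet q b).den_pos
  dsimp only
  rw [hd, Nat.mul_div_cancel_left _ hden]
  have hd0 : d ≠ 0 := fun h0 => by rw [h0, mul_zero] at hd; omega
  have hq : (G.bet q b : ℝ≥0) = (G.bet q b).num / (G.bet q b).den := by
    conv_lhs => rw [← NNRat.num_div_den (G.bet q b)]
    push_cast
    rfl
  have hden' : ((G.bet q b).den : ℝ≥0) ≠ 0 := by exact_mod_cast hden.ne'
  have hd' : (d : ℝ≥0) ≠ 0 := by exact_mod_cast hd0
  rw [hq]
  push_cast
  field_simp

open Classical in
/-- Whether `G` gains at least `2 ^ e` over the window `[j ^ 3, (j + 1) ^ 3)` of the image of `σ`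
under the parity map, where `e` is the length of the window divided by `K`. -/
noncomputable def gainTest (K j : ℕ) (σ : List Bool) : Bool :=
  decide ((2 : ℝ≥0) ^ (((j + 1) ^ 3 - j ^ 3) / K) ≤
    G.gain (G.stateQ (j ^ 3) (seqPrefix (parityMap h fun n => σ.getD n false) (j ^ 3))) (j ^ 3)
      (parityMap h fun n => σ.getD n false) ((j + 1) ^ 3 - j ^ 3))

theorem primrec₂_gainTest (K : ℕ) : Primrec₂ (G.gainTest K) := by
  have := G.finiteQ
  obtain ⟨k, ⟨e⟩⟩ := Finite.exists_equiv_fin G.Q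
  let _ : Primcodable G.Q := Primcodable.ofEquiv (Fin k) e
  obtain ⟨N, num, hN, hnum⟩ := G.exists_common_denominator
  have hY := primrec₂_parityMap h
  have hstate := G.primrec₂_runState hY
  have hnumP : Primrec fun a : G.Q × Bool => num a.1 a.2 := Primrec.dom_finite _
  have hcube : Primrec fun a : ℕ × List Bool => a.1 ^ 3 :=
    primrec_pow Primrec.fst (Primrec.const 3)
  have hl : Primrec fun a : ℕ × List Bool => (a.1 + 1) ^ 3 - a.1 ^ 3 :=
    Primrec.nat_sub.comp (primrec_pow (Primrec.succ.comp Primrec.fst) (Primrec.const 3)) hcube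
  have hf : Primrec₂ fun (a : ℕ × List Bool) (t : ℕ) =>
      num (G.runState G.q₀ 0 (parityMap h fun n => a.2.getD n false) (a.1 ^ 3 + t))
        (parityMap h (fun n => a.2.getD n false) (a.1 ^ 3 + t)) := by
    have hσ : Primrec fun c : (ℕ × List Bool) × ℕ => c.1.2 := Primrec.snd.comp Primrec.fst
    have hn : Primrec fun c : (ℕ × List Bool) × ℕ => c.1.1 ^ 3 + c.2 :=
      Primrec.nat_add.comp (hcube.comp Primrec.fst) Primrec.snd
    exact hnumP.comp ((hstate.comp hσ hn).pair (hY.comp hσ hn))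
  have hprod := primrec_prod_range hf hl
  have hdec := Primrec.nat_le.decide.comp
    (Primrec.nat_mul.comp (primrec_pow (Primrec.const 2)
      (Primrec.nat_div.comp hl (Primrec.const K))) (primrec_pow (Primrec.const N) hl))
    (Primrec.nat_mul.comp (primrec_pow (Primrec.const 2) hl) hprod)
  refine hdec.of_eq fun ⟨j, σ⟩ => ?_
  refine decide_eq_decide.2 ?_
  dsimp only
  rw [gain_eq_prod]
  simp only [hnum, mul_div_assoc', Finset.prod_div_distrib, Finset.prod_mul_distrib,
    Finset.prod_const, Finset.card_range]
  rw [le_div_iff₀ (by positivity)]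
  exact_mod_cast Iff.rfl

theorem stateQ_congr {S S' : ℕ → Bool} {n : ℕ} (hS : ∀ x < n, S x = S' x) :
    G.stateQ n (seqPrefix S n) = G.stateQ n (seqPrefix S' n) :=
  congrArg _ (funext fun x => hS x x.isLt)

/-- The gain over a window depends on the prefix up to the end of the window only. -/
theorem gain_stateQ_congr {S S' : ℕ → Bool} {n l : ℕ} (hS : ∀ x < n + l, S x = S' x) :
    G.gain (G.stateQ n (seqPrefix S n)) n S l = G.gain (G.stateQ n (seqPrefix S' n)) n S' l := by
  rw [G.stateQ_congr fun x hx => hS x (by omega)]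
  refine G.gain_congr fun s hs => ⟨hS _ (by omega), fun i => hS _ ?_⟩
  have := G.position_le (n + s) i
  omega

theorem length_filter_gainTest (K j : ℕ) :
    ((binStrings ((j + 1) ^ 3)).filter (G.gainTest K j)).length =
      (Finset.univ.filter fun τ : Fin ((j + 1) ^ 3) → Bool =>
        (2 : ℝ≥0) ^ (((j + 1) ^ 3 - j ^ 3) / K) ≤
        G.gain (G.stateQ (j ^ 3) (seqPrefix (parityMap h (extendFalse τ)) (j ^ 3))) (j ^ 3)
          (parityMap h (extendFalse τ)) ((j + 1) ^ 3 - j ^ 3)).card := by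
  classical
  have hext : ∀ τ : Fin ((j + 1) ^ 3) → Bool,
      (fun n => (List.ofFn τ).getD n false) = extendFalse τ := by
    intro τ
    funext n
    by_cases hn : n < (j + 1) ^ 3
    · rw [List.getD_eq_getElem _ _ (by simpa using hn)]
      simp [extendFalse, hn]
    · rw [List.getD_eq_default _ _ (by simpa using hn)]
      simp [extendFalse, hn]
  have htest : ∀ τ : Fin ((j + 1) ^ 3) → Bool, G.gainTest K j (List.ofFn τ) = true ↔
      (2 : ℝ≥0) ^ (((j + 1) ^ 3 - j ^ 3) / K) ≤
        G.gain (G.stateQ (j ^ 3) (seqPrefix (parityMap h (extendFalse τ)) (j ^ 3))) (j ^ 3)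
          (parityMap h (extendFalse τ)) ((j + 1) ^ 3 - j ^ 3) := by
    intro τ
    rw [gainTest, hext, decide_eq_true_iff]
  rw [← List.toFinset_card_of_nodup ((nodup_binStrings _).filter _)]
  symm
  refine Finset.card_bij (fun τ _ => List.ofFn τ) ?_ (fun _ _ _ _ h => List.ofFn_injective h) ?_
  · intro τ hτ
    simp only [List.mem_toFinset, List.mem_filter, mem_binStrings, List.length_ofFn, true_and]
    exact (htest τ).2 (Finset.mem_filter.1 hτ).2
  · intro σ hσ
    simp only [List.mem_toFinset, List.mem_filter, mem_binStrings] at hσ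
    obtain ⟨hlen, hgain⟩ := hσ
    have hof : List.ofFn (fun i : Fin ((j + 1) ^ 3) => σ.get (i.cast hlen.symm)) = σ :=
      List.ext_getElem (by simp [hlen]) fun n _ _ => by simp
    exact ⟨_, Finset.mem_filter.2 ⟨Finset.mem_univ _, (htest _).1 (hof.symm ▸ hgain)⟩, hof⟩

/-- On the image under the parity map of a random sequence, an `h`-head gambler eventually gains
less than any given exponential in the length of the window `[j ^ 3, (j + 1) ^ 3)`. -/
theorem eventually_gain_lt (hh : 1 ≤ h) {R : ℕ → Bool} (hR : IsMLRandom R) {K : ℕ} (hK : 0 < K) :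
    ∀ᶠ j in atTop, G.gain (G.stateQ (j ^ 3) (seqPrefix (parityMap h R) (j ^ 3))) (j ^ 3)
      (parityMap h R) ((j + 1) ^ 3 - j ^ 3) < 2 ^ (((j + 1) ^ 3 - j ^ 3) / K) := by
  classical
  have hm : Primrec fun j : ℕ => (j + 1) ^ 3 :=
    primrec_pow Primrec.succ (Primrec.const 3)
  obtain ⟨b, J, hJ⟩ := G.card_gain_parityMap_mul_le hh (4 * h * K)
  have hev := hR.eventually_eq_false (G.primrec₂_gainTest K) hm (by
    filter_upwards [eventually_ge_atTop J, eventually_ge_atTop (4 * K * (b + 2)),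
      eventually_ge_atTop 1] with j hj hj₂ hj₁
    have h₁ := hJ j hj (2 ^ (((j + 1) ^ 3 - j ^ 3) / K))
    rw [← G.length_filter_gainTest] at h₁
    have hl : j * j ≤ (j + 1) ^ 3 - j ^ 3 := by
      refine Nat.le_sub_of_add_le ?_
      nlinarith
    set L := ((binStrings ((j + 1) ^ 3)).filter (G.gainTest K j)).length
    set l := (j + 1) ^ 3 - j ^ 3
    have h₂ : L * 2 ^ (l / K) ≤
        2 ^ ((j + 1) ^ 3 + h * (l / pr (h + 1) ^ (4 * h * K)) + b) := by exact_mod_cast h₁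
    -- The exceptional positions cost a quarter of the exponent at most.
    have h₃ : h * (l / pr (h + 1) ^ (4 * h * K)) ≤ l / (4 * K) := by
      have hp : 4 * h * K ≤ pr (h + 1) ^ (4 * h * K) :=
        Nat.lt_two_pow_self.le.trans (Nat.pow_le_pow_left (prime_pr h).two_le _)
      calc h * (l / pr (h + 1) ^ (4 * h * K)) ≤ h * (l / (4 * h * K)) :=
            Nat.mul_le_mul_left _ (Nat.div_le_div_left hp (by positivity))
        _ = h * (l / (4 * K) / h) := by
            rw [Nat.div_div_eq_div_mul, show 4 * K * h = 4 * h * K by ring]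
        _ ≤ l / (4 * K) := Nat.mul_div_le _ _
    have h₄ : 4 * (l / (4 * K)) ≤ l / K := by
      rw [mul_comm 4 K, ← Nat.div_div_eq_div_mul]
      exact Nat.mul_div_le _ _
    have h₅ : j * (b + 2) ≤ l / (4 * K) := by
      rw [Nat.le_div_iff_mul_le (by positivity)]
      calc j * (b + 2) * (4 * K) = j * (4 * K * (b + 2)) := by ring
        _ ≤ j * j := Nat.mul_le_mul_left _ hj₂
        _ ≤ l := hl
    have h₆ : 2 * j + b ≤ j * (b + 2) := by nlinarith
    have h₇ : (j + 1) ^ 3 + h * (l / pr (h + 1) ^ (4 * h * K)) + b + 2 * j ≤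
        (j + 1) ^ 3 + l / K := by omega
    refine Nat.le_of_mul_le_mul_right (c := 2 ^ (l / K)) ?_ (by positivity)
    calc L * 4 ^ j * 2 ^ (l / K) = L * 2 ^ (l / K) * 2 ^ (2 * j) := by
          rw [pow_mul]; ring
      _ ≤ 2 ^ ((j + 1) ^ 3 + h * (l / pr (h + 1) ^ (4 * h * K)) + b) * 2 ^ (2 * j) :=
          Nat.mul_le_mul_right _ h₂
      _ ≤ 2 ^ ((j + 1) ^ 3) * 2 ^ (l / K) := by
          rw [← pow_add, ← pow_add]
          exact Nat.pow_le_pow_right (by norm_num) h₇)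
  filter_upwards [hev] with j hj
  rw [gainTest, decide_eq_false_iff_not, not_le] at hj
  have hjj : j ^ 3 ≤ (j + 1) ^ 3 := Nat.pow_le_pow_left (Nat.le_succ j) 3
  rwa [G.gain_stateQ_congr (S' := parityMap h R)] at hj
  intro x hx
  refine parityMap_congr fun n hn => ?_
  rw [List.getD_eq_getElem _ _ (by simp; omega)]
  simp [seqPrefix]

end HeadGambler

/-! ### Bounds on the predimensions -/

theorem exists_cube_window (n : ℕ) : ∃ j, j ^ 3 ≤ n ∧ n < (j + 1) ^ 3 := by
  induction n with
  | zero => exact ⟨0, by norm_num, by norm_num⟩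
  | succ n ih =>
    obtain ⟨j, h₁, h₂⟩ := ih
    rcases lt_or_ge (n + 1) ((j + 1) ^ 3) with h | h
    · exact ⟨j, by omega, h⟩
    · exact ⟨j + 1, h, lt_of_le_of_lt (show n + 1 ≤ (j + 1) ^ 3 from h₂)
        (Nat.pow_lt_pow_left (Nat.lt_succ_self _) (by norm_num))⟩

namespace HeadGambler

variable {h : ℕ} (G : HeadGambler h Bool)

theorem gain_le_two_pow (q : G.Q) (n₀ : ℕ) (S : ℕ → Bool) (l : ℕ) : G.gain q n₀ S l ≤ 2 ^ l := by
  rw [gain]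
  refine (Finset.prod_le_pow_card _ _ 2 fun t _ => ?_).trans (by simp)
  have hle : G.bet (G.runState q n₀ S t) (S (n₀ + t)) ≤ 1 := by
    rw [← G.bet_sum (G.runState q n₀ S t)]
    exact Finset.single_le_sum (f := G.bet (G.runState q n₀ S t)) (fun _ _ => zero_le)
      (Finset.mem_univ _)
  have hle' : (G.bet (G.runState q n₀ S t) (S (n₀ + t)) : ℝ≥0) ≤ 1 := by exact_mod_cast hle
  simpa using mul_le_mul_right hle' 2

/-- If the gains over the windows `[j ^ 3, (j + 1) ^ 3)` are eventually less than each exponential,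
then no `s`-gale with `s < 1` succeeds: the windows are so short that what happens inside one of
them does not matter. -/
theorem notMem_successSet_gale {S : ℕ → Bool}
    (hS : ∀ K, 0 < K → ∀ᶠ j in atTop, G.gain (G.stateQ (j ^ 3) (seqPrefix S (j ^ 3))) (j ^ 3)
      S ((j + 1) ^ 3 - j ^ 3) < 2 ^ (((j + 1) ^ 3 - j ^ 3) / K))
    {s : ℝ} (hs : s < 1) : S ∉ successSet (G.gale s) := by
  obtain ⟨K, hK⟩ := exists_nat_ge (2 / (1 - s))
  have hs' : 0 < 1 - s := by linarith
  have hK0 : (0 : ℝ) < K := lt_of_lt_of_le (by positivity) hK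
  have hK1 : (1 : ℝ) / K ≤ (1 - s) / 2 := by
    rw [div_le_div_iff₀ hK0 (by norm_num)]
    rw [div_le_iff₀ hs'] at hK
    linarith
  obtain ⟨J, hJ⟩ := eventually_atTop.1 (hS K (by exact_mod_cast hK0))
  set M := G.martingale (J ^ 3) (seqPrefix S (J ^ 3)) with hM
  have hjj : ∀ j : ℕ, j ^ 3 ≤ (j + 1) ^ 3 := fun j => Nat.pow_le_pow_left (Nat.le_succ j) 3
  have hcube : ∀ j ≥ J, G.martingale (j ^ 3) (seqPrefix S (j ^ 3)) ≤
      M * (2 : ℝ≥0) ^ (((j ^ 3 : ℕ) : ℝ) / K) := by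
    intro j hj
    induction j, hj using Nat.le_induction with
    | base => exact le_mul_of_one_le_right' (NNReal.one_le_rpow (by norm_num) (by positivity))
    | succ j hj ih =>
      have hstep := G.martingale_add (j ^ 3) S ((j + 1) ^ 3 - j ^ 3)
      rw [Nat.add_sub_cancel' (hjj j)] at hstep
      rw [hstep]
      refine (mul_le_mul' ih (hJ j hj).le).trans ?_
      rw [mul_assoc]
      gcongr
      rw [← NNReal.rpow_natCast, ← NNReal.rpow_add (by norm_num)]
      refine NNReal.rpow_le_rpow_of_exponent_le (by norm_num) ?_
      refine (add_le_add_right (Nat.cast_div_le (m := (j + 1) ^ 3 - j ^ 3) (n := K)) _).trans ?_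
      rw [Nat.cast_sub (hjj j), ← add_div]
      simp
  have hbound : ∀ᶠ n in atTop, (G.gale s n (seqPrefix S n) : ℝ≥0∞) ≤ M := by
    obtain ⟨j₀, hj₀⟩ := exists_nat_ge (14 / (1 - s))
    filter_upwards [eventually_ge_atTop ((J + j₀ + 1) ^ 3)] with n hn
    obtain ⟨j, hjn, hnj⟩ := exists_cube_window n
    have hlt : J + j₀ + 1 < j + 1 := lt_of_pow_lt_pow_left₀ 3 (by positivity) (hn.trans_lt hnj)
    obtain ⟨t, rfl⟩ := Nat.exists_eq_add_of_le hjn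
    rw [ENNReal.coe_le_coe, gale, G.martingale_add, Fintype.card_bool]
    have h₁ := mul_le_mul' (hcube j (by omega))
      (G.gain_le_two_pow (G.stateQ (j ^ 3) (seqPrefix S (j ^ 3))) (j ^ 3) S t)
    refine (mul_le_mul_right h₁ _).trans ?_
    rw [← NNReal.rpow_natCast, mul_assoc M, mul_left_comm, ← NNReal.rpow_add (by norm_num),
      Nat.cast_ofNat, ← NNReal.rpow_add (by norm_num)]
    refine mul_le_of_le_one_right' ?_
    rw [← NNReal.rpow_zero 2]
    refine NNReal.rpow_le_rpow_of_exponent_le (by norm_num) ?_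
    have hj1 : (1 : ℝ) ≤ j := by exact_mod_cast (by omega : 1 ≤ j)
    have ht : (t : ℝ) ≤ 7 * (j : ℝ) ^ 2 := by
      have : t ≤ 3 * j ^ 2 + 3 * j + 1 := by
        have : (j + 1) ^ 3 = j ^ 3 + (3 * j ^ 2 + 3 * j + 1) := by ring
        omega
      have : (t : ℝ) ≤ 3 * (j : ℝ) ^ 2 + 3 * j + 1 := by exact_mod_cast this
      nlinarith
    have hj14 : 14 ≤ (1 - s) * j := by
      have : (j₀ : ℝ) ≤ j := by exact_mod_cast (by omega : j₀ ≤ j)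
      have := hj₀.trans this
      rwa [div_le_iff₀' hs'] at this
    push_cast
    have h₂ : (j : ℝ) ^ 3 / K ≤ (1 - s) / 2 * (j : ℝ) ^ 3 := by
      rw [div_eq_mul_one_div, mul_comm]
      exact mul_le_mul_of_nonneg_right hK1 (by positivity)
    have h₃ : 14 * (j : ℝ) ^ 2 ≤ (1 - s) * (j : ℝ) ^ 3 := by
      calc 14 * (j : ℝ) ^ 2 ≤ (1 - s) * j * (j : ℝ) ^ 2 :=
            mul_le_mul_of_nonneg_right hj14 (by positivity)
        _ = _ := by ring
    have h₄ : (s - 1) * t ≤ 0 :=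
      mul_nonpos_of_nonpos_of_nonneg (by linarith) (Nat.cast_nonneg t)
    linarith
  intro hmem
  have hle : limsup (fun n => (G.gale s n (seqPrefix S n) : ℝ≥0∞)) atTop ≤ M :=
    limsup_le_of_le (h := hbound)
  rw [show limsup (fun n => (G.gale s n (seqPrefix S n) : ℝ≥0∞)) atTop = ⊤ from hmem] at hle
  exact ENNReal.coe_ne_top (top_le_iff.1 hle)

/-- A gale that is bounded below by an increasing exponential succeeds strongly. -/
theorem mem_strongSuccessSet_of_le {s ε C : ℝ} (hε : 0 < ε) {S : ℕ → Bool}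
    (hle : ∀ n : ℕ, (2 : ℝ≥0) ^ (ε * n - C) ≤ G.gale s n (seqPrefix S n)) :
    S ∈ strongSuccessSet (G.gale s) := by
  have hlin : Tendsto (fun n : ℕ => ε * (n : ℝ) - C) atTop atTop :=
    tendsto_atTop_add_const_right _ _ (tendsto_natCast_atTop_atTop.const_mul_atTop hε)
  have hpow : Tendsto (fun n : ℕ => (2 : ℝ≥0) ^ (ε * (n : ℝ) - C)) atTop atTop := by
    rw [← NNReal.tendsto_coe_atTop]
    simp only [NNReal.coe_rpow, NNReal.coe_ofNat]
    exact (tendsto_rpow_atTop_of_base_gt_one 2 (by norm_num)).comp hlin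
  exact (ENNReal.tendsto_coe_nhds_top.2 (tendsto_atTop_mono hle hpow)).liminf_eq

end HeadGambler

theorem strongSuccessSet_subset {α : Type} (d : (n : ℕ) → (Fin n → α) → ℝ≥0) :
    strongSuccessSet d ⊆ successSet d := fun S hS =>
  top_le_iff.1 <|
    (show liminf (fun n => (d n (seqPrefix S n) : ℝ≥0∞)) atTop = ⊤ from hS).symm.le.trans
      liminf_le_limsup

/-- The gambler that never bets. -/
def uniformGambler (h : ℕ) : HeadGambler h Bool where
  T := Unit
  Q := Unit
  stepT := id
  stepQ _ _ _ := ()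
  move _ _ := false
  bet _ _ := 1 / 2
  bet_sum _ := by simp
  t₀ := ()
  q₀ := ()
  c₀ := 1

theorem martingale_uniformGambler (h n : ℕ) (w : Fin n → Bool) :
    (uniformGambler h).martingale n w = 1 := by
  induction n with
  | zero => rfl
  | succ n ih =>
    rw [HeadGambler.martingale, ih]
    simp [uniformGambler]

/-- The gambler with trailing heads of speeds `p_k / p`, for `k = 1, ..., h`. It computes the parity
of the bits that the trailing heads read in the step before the leading head reaches a positive
multiple of `p`, and bets everything on that parity; at other positions it does not bet. -/
noncomputable def parityGambler (h : ℕ) : HeadGambler (h + 1) Bool where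
  T := ZMod (pr (h + 1))
  Q := ZMod (pr (h + 1)) × Option Bool
  finiteT := haveI : NeZero (pr (h + 1)) := ⟨(prime_pr h).ne_zero⟩; inferInstance
  finiteQ := haveI : NeZero (pr (h + 1)) := ⟨(prime_pr h).ne_zero⟩; inferInstance
  stepT t := t + 1
  stepQ q b _ := (q.1 + 1, if q.1 + 1 = 0 then some ((List.ofFn b).foldr xor false) else none)
  move t k := decide (t.val < pr ((k : ℕ) + 1))
  bet q a := q.2.elim (1 / 2) fun b => if a = b then 1 else 0
  bet_sum q := by rcases q with ⟨t, _ | _ | _⟩ <;> simp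
  t₀ := 0
  q₀ := (0, none)
  c₀ := 1

theorem parityGambler_stepT_iterate (h n : ℕ) :
    @Eq (ZMod (pr (h + 1))) ((parityGambler h).stepT^[n] (parityGambler h).t₀) n := by
  induction n with
  | zero => exact (Nat.cast_zero).symm
  | succ n ih =>
    rw [Function.iterate_succ_apply', ih]
    exact (Nat.cast_succ n).symm

theorem parityGambler_position (h n : ℕ) (k : Fin h) : (parityGambler h).position n k =
    n / pr (h + 1) * pr (k + 1) + min (n % pr (h + 1)) (pr (k + 1)) := by
  have hlt := pr_lt_pr k.isLt
  induction n with
  | zero => simp [HeadGambler.position]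
  | succ n ih =>
    have hmove : ((parityGambler h).move ((parityGambler h).stepT^[n] (parityGambler h).t₀) k).toNat
        = if n % pr (h + 1) < pr (k + 1) then 1 else 0 := by
      change (decide (ZMod.val (n := pr (h + 1))
        ((parityGambler h).stepT^[n] (parityGambler h).t₀) < pr ((k : ℕ) + 1))).toNat = _
      rw [parityGambler_stepT_iterate, ZMod.val_natCast]
      split_ifs with hc <;> simp [hc]
    have hstep : (parityGambler h).position (n + 1) k = (parityGambler h).position n k +
      ((parityGambler h).move ((parityGambler h).stepT^[n] (parityGambler h).t₀) k).toNat := rfl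
    rw [hstep, hmove, ih]
    have hmod := Nat.mod_lt n (prime_pr h).pos
    have h₁ := Nat.div_add_mod n (pr (h + 1))
    rcases lt_or_ge (n % pr (h + 1) + 1) (pr (h + 1)) with hc | hc
    · have hdiv : (n + 1) / pr (h + 1) = n / pr (h + 1) := by
        rw [Nat.div_eq_iff (prime_pr h).pos, mul_comm]; constructor <;> omega
      have hmod' : (n + 1) % pr (h + 1) = n % pr (h + 1) + 1 := by
        have := Nat.div_add_mod (n + 1) (pr (h + 1))
        rw [hdiv] at this; omega
      rw [hdiv, hmod']
      split_ifs <;> omega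
    · have hn : n + 1 = pr (h + 1) * (n / pr (h + 1) + 1) := by rw [mul_add]; omega
      rw [hn, Nat.mul_div_cancel_left _ (prime_pr h).pos, Nat.mul_mod_right, if_neg (by omega),
        min_eq_right (by omega), add_mul]
      simp

theorem parityGambler_stateQ (h : ℕ) (R : ℕ → Bool) (n : ℕ) :
    (parityGambler h).stateQ n (seqPrefix (parityMap h R) n) =
      ((n : ZMod (pr (h + 1))),
        if n ≠ 0 ∧ pr (h + 1) ∣ n then some (parityMap h R n) else none) := by
  induction n with
  | zero => rw [if_neg (by simp), Nat.cast_zero]; rfl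
  | succ n ih =>
    have hstep : (parityGambler h).stateQ (n + 1) (seqPrefix (parityMap h R) (n + 1)) =
        (parityGambler h).stepQ ((parityGambler h).stateQ n (seqPrefix (parityMap h R) n))
          (fun k : Fin h => parityMap h R ((parityGambler h).position n k))
          (parityMap h R n) := rfl
    rw [hstep, ih]
    change (((n : ZMod (pr (h + 1))) + 1), if (n : ZMod (pr (h + 1))) + 1 = 0 then
      some ((List.ofFn fun k : Fin h =>
        parityMap h R ((parityGambler h).position n k)).foldr xor false) else none) = _
    have hzero : (n : ZMod (pr (h + 1))) + 1 = 0 ↔ pr (h + 1) ∣ n + 1 := by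
      rw [← Nat.cast_succ, ZMod.natCast_eq_zero_iff]
    rw [← Nat.cast_succ] at hzero ⊢
    by_cases hd : pr (h + 1) ∣ n + 1
    · rw [if_pos (hzero.2 hd), if_pos ⟨Nat.succ_ne_zero n, hd⟩]
      obtain ⟨q, hq⟩ := hd
      have hp := (prime_pr h).pos
      have hq0 : 0 < q := Nat.pos_of_ne_zero fun h0 => by simp [h0] at hq
      obtain ⟨r, rfl⟩ : ∃ r, q = r + 1 := ⟨q - 1, by omega⟩
      have hn : n = (pr (h + 1) - 1) + pr (h + 1) * r := by rw [mul_add] at hq; omega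
      have hpos : ∀ k : Fin h, (parityGambler h).position n k = (r + 1) * pr (k + 1) := by
        intro k
        have hlt := pr_lt_pr k.isLt
        rw [parityGambler_position]
        have h₁ : n / pr (h + 1) = r := by
          rw [hn, Nat.add_mul_div_left _ _ hp, Nat.div_eq_of_lt (by omega), zero_add]
        have h₂ : n % pr (h + 1) = pr (h + 1) - 1 := by
          rw [hn, Nat.add_mul_mod_self_left, Nat.mod_eq_of_lt (by omega)]
        rw [h₁, h₂, min_eq_right (by omega)]; ring
      simp only [hpos]
      rw [Nat.succ_eq_add_one, hq, mul_comm, parityMap_mul R hq0]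
    · rw [if_neg (mt hzero.1 hd), if_neg fun hc => hd hc.2]

/-- On the image of the parity map, the parity gambler doubles its capital at each positive multiple
of `p`. -/
theorem parityGambler_martingale (h : ℕ) (R : ℕ → Bool) (n : ℕ) :
    (parityGambler h).martingale n (seqPrefix (parityMap h R) n) = 2 ^ ((n - 1) / pr (h + 1)) := by
  induction n with
  | zero => simp [HeadGambler.martingale, parityGambler]
  | succ n ih =>
    have hstep : (parityGambler h).martingale (n + 1) (seqPrefix (parityMap h R) (n + 1)) =
        Fintype.card Bool * (parityGambler h).martingale n (seqPrefix (parityMap h R) n) *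
        ((parityGambler h).bet ((parityGambler h).stateQ n (seqPrefix (parityMap h R) n))
          (parityMap h R n) : ℝ≥0) := rfl
    rw [hstep, ih, parityGambler_stateQ, Fintype.card_bool]
    rcases n with _ | n
    · simp [parityGambler]
    · simp only [Nat.add_sub_cancel, Nat.succ_div]
      by_cases hd : pr (h + 1) ∣ n + 1
      · simp [parityGambler, hd, pow_succ, mul_comm]
      · simp [parityGambler, hd, mul_comm]

theorem parityMap_mem_strongSuccessSet (h : ℕ) (R : ℕ → Bool) {s : ℝ}
    (hs : 1 - 1 / (pr (h + 1) : ℝ) < s) :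
    parityMap h R ∈ strongSuccessSet ((parityGambler h).gale s) := by
  have hp : (0 : ℝ) < pr (h + 1) := by exact_mod_cast (prime_pr h).pos
  refine HeadGambler.mem_strongSuccessSet_of_le _ (ε := s - 1 + 1 / (pr (h + 1) : ℝ)) (C := 1)
    (by linarith) fun n => ?_
  rw [HeadGambler.gale, parityGambler_martingale, Fintype.card_bool, Nat.cast_ofNat,
    ← NNReal.rpow_natCast, ← NNReal.rpow_add (by norm_num)]
  refine NNReal.rpow_le_rpow_of_exponent_le (by norm_num) ?_
  have hle : n ≤ pr (h + 1) * ((n - 1) / pr (h + 1) + 1) := by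
    have h₁ := Nat.div_add_mod (n - 1) (pr (h + 1))
    have h₂ := Nat.mod_lt (n - 1) (prime_pr h).pos
    rw [mul_add]; omega
  have hle' : (n : ℝ) / pr (h + 1) ≤ ((n - 1) / pr (h + 1) : ℕ) + 1 := by
    rw [div_le_iff₀' hp]
    exact_mod_cast hle
  calc (s - 1 + 1 / (pr (h + 1) : ℝ)) * n - 1 = (s - 1) * n + (n / pr (h + 1) - 1) := by ring
    _ ≤ _ := by linarith

theorem mem_strongSuccessSet_uniformGambler (h : ℕ) (S : ℕ → Bool) {s : ℝ} (hs : 1 < s) :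
    S ∈ strongSuccessSet ((uniformGambler h).gale s) := by
  refine HeadGambler.mem_strongSuccessSet_of_le _ (ε := s - 1) (C := 0) (by linarith) fun n => ?_
  rw [HeadGambler.gale, martingale_uniformGambler, Fintype.card_bool]
  simp

theorem seqStrongPredim_le_of_forall_gt {h : ℕ} {S : ℕ → Bool} {x : ℝ} (hx : 0 ≤ x)
    (hS : ∀ s, x < s → ∃ G : HeadGambler h Bool, S ∈ strongSuccessSet (G.gale s)) :
    seqStrongPredim h S ≤ x := by
  refine le_of_forall_gt_imp_ge_of_dense fun s hs => csInf_le ⟨0, fun _ h => h.1⟩ ?_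
  obtain ⟨G, hG⟩ := hS s hs
  exact ⟨hx.trans hs.le, G, by simpa using hG⟩

theorem seqPredim_le_seqStrongPredim (h : ℕ) (S : ℕ → Bool) :
    seqPredim h S ≤ seqStrongPredim h S := by
  refine csInf_le_csInf ⟨0, fun _ h => h.1⟩ ⟨2, by norm_num, uniformGambler h, ?_⟩ ?_
  · simpa using mem_strongSuccessSet_uniformGambler h S (by norm_num)
  · rintro s ⟨hs, G, hG⟩
    exact ⟨hs, G, hG.trans (strongSuccessSet_subset _)⟩

theorem one_le_seqPredim {h : ℕ} {S : ℕ → Bool}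
    (hS : ∀ (G : HeadGambler h Bool) (s : ℝ), s < 1 → S ∉ successSet (G.gale s)) :
    1 ≤ seqPredim h S := by
  refine le_csInf ⟨2, by norm_num, uniformGambler h, ?_⟩ ?_
  · simpa using strongSuccessSet_subset _
      (mem_strongSuccessSet_uniformGambler h S (s := 2) (by norm_num))
  · rintro s ⟨-, G, hG⟩
    by_contra! hs
    exact hS G s hs (by simpa using hG)

theorem theorem1 (h : ℕ) (hh : 1 ≤ h) :
    (∃ Y : ℕ → Bool, (∃ R : ℕ → Bool, IsMLRandom R ∧ Y = parityMap h R) ∧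
      seqPredim (h + 1) Y < seqPredim h Y ∧
      seqStrongPredim (h + 1) Y < seqStrongPredim h Y) ∧
    ∀ R : ℕ → Bool, IsMLRandom R →
      seqPredim h (parityMap h R) = 1 ∧
      seqStrongPredim h (parityMap h R) = 1 ∧
      seqPredim (h + 1) (parityMap h R) ≤ seqStrongPredim (h + 1) (parityMap h R) ∧
      seqStrongPredim (h + 1) (parityMap h R) ≤ 1 - 1 / (pr (h + 1) : ℝ) := by
  have hp : (1 : ℝ) < pr (h + 1) := by exact_mod_cast (prime_pr h).one_lt
  have hinv : 1 / (pr (h + 1) : ℝ) < 1 := by rw [div_lt_one (by linarith)]; exact hp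
  have hinv0 : 0 < 1 / (pr (h + 1) : ℝ) := by positivity
  have main : ∀ R : ℕ → Bool, IsMLRandom R →
      seqPredim h (parityMap h R) = 1 ∧
      seqStrongPredim h (parityMap h R) = 1 ∧
      seqPredim (h + 1) (parityMap h R) ≤ seqStrongPredim (h + 1) (parityMap h R) ∧
      seqStrongPredim (h + 1) (parityMap h R) ≤ 1 - 1 / (pr (h + 1) : ℝ) := by
    intro R hR
    have hlow : 1 ≤ seqPredim h (parityMap h R) := one_le_seqPredim fun G s hs =>
      G.notMem_successSet_gale (fun K hK => G.eventually_gain_lt hh hR hK) hs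
    have hup : seqStrongPredim h (parityMap h R) ≤ 1 :=
      seqStrongPredim_le_of_forall_gt zero_le_one fun s hs =>
        ⟨_, mem_strongSuccessSet_uniformGambler h _ hs⟩
    have hmid := seqPredim_le_seqStrongPredim h (parityMap h R)
    exact ⟨le_antisymm (hmid.trans hup) hlow, le_antisymm hup (hlow.trans hmid),
      seqPredim_le_seqStrongPredim _ _, seqStrongPredim_le_of_forall_gt (by linarith)
        fun s hs => ⟨_, parityMap_mem_strongSuccessSet h R hs⟩⟩
  obtain ⟨R, hR⟩ := exists_isMLRandom
  obtain ⟨h₁, h₂, h₃, h₄⟩ := main R hR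
  exact ⟨⟨_, ⟨R, hR, rfl⟩, by linarith, by linarith⟩, main⟩
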